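/- **Localization game.** Let $G$ be a finite connected simple graph and $k$ a natural number. An invisible robber first chooses a vertex. In each round $k$ cops choose arbitrary vertices $c_1,\dots,c_k$ (not necessarily distinct, and unrestricted by their earlier choices) and learn the distance vector $(d(c_1,r),\dots,d(c_k,r))$, where $r$ is the robber's present vertex; afterwards the robber stays where he is or moves to a neighbor. The choices of the cops may depend on all distance vectors obtained so far, and the robber is omniscient. The robber is located in a round if, right after the probe of that round, the distance vectors obtained so far determine his present vertex. The $k$-localization capture time $\mathrm{lcapt}_k(G)\in\mathbb N\cup\{\infty\}$ is the least $m$ such that $k$ cops have a strategy that locates the robber within $m$ rounds, whatever he does ($\infty$ if there is no such $m$). The localization number $\zeta(G)$ is the least $k$ with $\mathrm{lcapt}_k(G)<\infty$, and $\mathrm{lcapt}(G)=\mathrm{lcapt}_{\zeta(G)}(G)$. **Outerplanar graphs.** A graph is outerplanar if it can be drawn in the plane without crossings so that all vertices lie on the outer face, that is, if it can be drawn without crossings in a closed disc with all vertices on the boundary circle and every edge a continuous arc in the disc. A graph is 2-connected if it has at least three vertices, is connected, and stays connected after the removal of any one vertex. **Proposition.** Let $G$ be a finite 2-connected outerplanar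 graph on $n$ vertices. Then $G$ has a Hamiltonian cycle (its outer cycle). If $C$ is a Hamiltonian cycle of $G$ and $c$ is the number of chords of $G$, i.e. of edges of $G$ that are not edges of $C$, then $$\mathrm{lcapt}_2(G)\le c+1 ,$$ that is, two cops can locate the robber within $c+1$ rounds. Consequently, if $\zeta(G)=2$, then $\mathrm{lcapt}(G)\le n-2$. -/

import Mathlib

namespace SimpleGraph

/-! ### Two-connected graphs -/

/-- A graph is 2-connected if it has at least three vertices, is connected, and remains connected
after the removal of any single vertex. -/
def IsTwoConnected {V : Type*} (G : SimpleGraph V) : Prop :=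
  3 ≤ Nat.card V ∧ G.Connected ∧ ∀ v : V, (G.induce {v}ᶜ).Connected

/-! ### Outerplanar graphs -/

/-- The subset `A` of the plane is an arc (a homeomorphic image of the unit interval) with
end points `x` and `y`. -/
def IsArcBetween (A : Set ℂ) (x y : ℂ) : Prop :=
  ∃ γ : _root_.Path x y, Function.Injective γ ∧ Set.range γ = A

/-- A crossing-free drawing of the graph `G` in the closed unit disc of the plane, with all
vertices on the boundary circle of the disc.  The edges are arbitrary continuous arcs. -/
structure OuterplanarDrawing {V : Type*} (G : SimpleGraph V) where
  /-- the point that represents a vertex -/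
  pos : V → ℂ
  /-- the arc that represents an edge (irrelevant for pairs that are not edges) -/
  arc : Sym2 V → Set ℂ
  pos_injective : Function.Injective pos
  /-- the vertices lie on the unit circle -/
  norm_pos : ∀ v, ‖pos v‖ = 1
  /-- every edge is drawn as an arc joining its two ends -/
  isArcBetween : ∀ u v, G.Adj u v → IsArcBetween (arc s(u, v)) (pos u) (pos v)
  /-- the edges stay inside the closed unit disc -/
  arc_subset : ∀ e ∈ G.edgeSet, arc e ⊆ Metric.closedBall 0 1
  /-- an edge passes through no vertex other than its ends -/
  mem_of_pos_mem_arc : ∀ e ∈ G.edgeSet, ∀ w, pos w ∈ arc e → w ∈ e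
  /-- two different edges meet at most in common ends -/
  arc_inter_subset : ∀ e ∈ G.edgeSet, ∀ f ∈ G.edgeSet, e ≠ f →
    arc e ∩ arc f ⊆ pos '' {v | v ∈ e ∧ v ∈ f}

/-- A graph is outerplanar if it can be drawn in the plane without crossings so that all of its
vertices lie on the outer face: the drawing is contained in a closed disc and the vertices lie
on the boundary circle of the disc. -/
def IsOuterplanar {V : Type*} (G : SimpleGraph V) : Prop :=
  Nonempty G.OuterplanarDrawing

/-! ### The localization game -/

/-- The robber's positions over time: `r t` is the robber's vertex when the cops probe for the
`(t + 1)`-st time.  The first one is arbitrary; after each probe the robber stays or moves to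
a neighbor. -/
def IsRobberTrajectory {V : Type*} (G : SimpleGraph V) (r : ℕ → V) : Prop :=
  ∀ t, r (t + 1) = r t ∨ G.Adj (r t) (r (t + 1))

/-- A strategy of `k` cops: given the list of all distance vectors obtained so far, it chooses the
`k` vertices to probe next. -/
abbrev CopStrategy (V : Type*) (k : ℕ) : Type _ :=
  List (Fin k → ℕ) → Fin k → V

/-- The list of the first `t` distance vectors that the cops obtain when they follow `σ` and the
robber follows `r`. -/
noncomputable def answers {V : Type*} (G : SimpleGraph V) {k : ℕ} (σ : CopStrategy V k)
    (r : ℕ → V) : ℕ → List (Fin k → ℕ)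
  | 0 => []
  | t + 1 => answers G σ r t ++ [fun i => G.dist (σ (answers G σ r t) i) (r t)]

/-- `k` cops can guarantee to locate the robber within `m` rounds: they have a strategy such that,
whatever the robber does, right after one of the first `m` probes the distance vectors obtained
so far determine the present position of the robber. -/
def CopsLocateWithin {V : Type*} (G : SimpleGraph V) (k m : ℕ) : Prop :=
  ∃ σ : CopStrategy V k, ∀ r : ℕ → V, G.IsRobberTrajectory r →
    ∃ t < m, ∀ r' : ℕ → V, G.IsRobberTrajectory r' →
      answers G σ r' (t + 1) = answers G σ r (t + 1) → r' t = r t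

/-- The localization number `ζ(G)` (of a connected graph): the least number of cops that
can locate the robber within a finite number of rounds. -/
noncomputable def localizationNumber {V : Type*} (G : SimpleGraph V) : ℕ :=
  sInf {k | ∃ m, G.CopsLocateWithin k m}

/-- The `k`-localization capture time `lcapt_k(G)` (of a connected graph): the least number of
rounds within which `k` cops can guarantee to locate the robber; it is `⊤` if there is none. -/
noncomputable def kLocalizationCaptureTime {V : Type*} (G : SimpleGraph V) (k : ℕ) : ℕ∞ :=
  ⨅ m ∈ {m : ℕ | G.CopsLocateWithin k m}, (m : ℕ∞)

/-- The localization capture time `lcapt(G)`, which is `lcapt_k(G)` for `k = ζ(G)`. -/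
noncomputable def localizationCaptureTime {V : Type*} (G : SimpleGraph V) : ℕ∞ :=
  G.kLocalizationCaptureTime G.localizationNumber

end SimpleGraph

/-!
Cutting the circle of an outerplanar drawing at a point puts the vertices into a linear order.
Edges do not cross, because two paths in a disc whose ends interleave on the circle meet
(`Complex.exists_mem_range_of_interleaved`): otherwise the difference of the two paths would have
a continuous logarithm on the square of the parameters, but along each side of the square the
increment of the argument is known, and these increments do not cancel.  Two-connectedness makes
consecutive vertices adjacent, and also the first and the last one (`NonCrossing.adj_of_covBy`,
`NonCrossing.adj_of_forall_adj_lt`); this is the outer cycle.  From here on the argument uses only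
the order.

For an edge `uv` with `u < v` let `f(u, v)` be the number of edges `ab` with `u ≤ a < b ≤ v` that do
not join consecutive vertices.  For the first and the last vertex this number is at most one more
than the number of chords, by comparing numbers of edges, and at most `n - 2`, since every chord has
a private vertex below it (`NonCrossing.card_chordFinset_le`).  So it suffices to show, by induction
on `f(u, v)`, that the cops win within `f(u, v)` rounds if they know the robber to be in `[u, v]`
(`IsOuterOrder.winsBelow`).

Consider the inner face `u = w 0 < ⋯ < w k = v` below the edge `uv`.  The face is an isometric
cycle, and a vertex between `w i` and `w (i + 1)` has distances from the face that are determined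
by those from these two vertices.  A chord below an edge of the face is not one below another
edge, and `uv` is below none of them, which saves rounds.

* If only two consecutive edges of the face have vertices below them, then one probe at two
  adjacent vertices opposite to their common vertex tells below which of the edges the robber is,
  or else that he is close to their common vertex (`IsFace.wins_of_covBy`).
* Otherwise there are two rounds to spare.  A probe of `u` and `v` tells in which half of the face
  the robber is, and a probe of the ends of this half gives the same information as in the first
  case (`IsFace.wins_of_two_probes`).

It remains to find a robber below one of two consecutive edges `yw` and `wz`, with as many rounds
as there are chords below them (`WinsBelow.wins_Ioo`, `WinsBelow.wins_Icc`).  A probe opposite to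
`w` on the face below `wz` confines the robber to one side, or else replaces `wz` by the first
edge of that face, below which there are fewer chords (`WinsBelow.wins_Ico`).
-/

/-! ### Paths in a disc with interleaved ends -/

namespace Complex

theorem arg_one_sub_exp {θ : ℝ} (h0 : 0 < θ) (h1 : θ < 2 * Real.pi) :
    arg (1 - exp (θ * I)) = (θ - Real.pi) / 2 := by
  have hs : 0 < Real.sin (θ / 2) := Real.sin_pos_of_pos_of_lt_pi (by linarith) (by linarith)
  have key : 1 - exp (θ * I) =
      ((2 * Real.sin (θ / 2) : ℝ) : ℂ) *
        (Complex.cos (((θ - Real.pi) / 2 : ℝ)) + Complex.sin (((θ - Real.pi) / 2 : ℝ)) * I) := by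
    have e1 : Complex.cos (((θ - Real.pi) / 2 : ℝ)) = Complex.sin (θ / 2) := by
      rw [show (((θ - Real.pi) / 2 : ℝ) : ℂ) = θ / 2 - Real.pi / 2 by push_cast; ring,
        Complex.cos_sub_pi_div_two]
    have e2 : Complex.sin (((θ - Real.pi) / 2 : ℝ)) = -Complex.cos (θ / 2) := by
      rw [show (((θ - Real.pi) / 2 : ℝ) : ℂ) = θ / 2 - Real.pi / 2 by push_cast; ring,
        Complex.sin_sub_pi_div_two]
    have e3 := Complex.cos_two_mul (θ / 2 : ℂ)
    have e4 := Complex.sin_two_mul (θ / 2 : ℂ)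
    have e5 := Complex.sin_sq_add_cos_sq (θ / 2 : ℂ)
    rw [mul_div_cancel₀ _ (two_ne_zero)] at e3 e4
    rw [e1, e2, exp_mul_I, e3, e4]
    push_cast
    linear_combination (-2 : ℂ) * e5
  rw [key, arg_mul_cos_add_sin_mul_I (by positivity)]
  constructor <;> linarith

/-- The imaginary part of a logarithm along a curve in a half plane with the origin on its boundary
changes by as much as the principal argument does. -/
theorem im_log_increment {L z : ℝ → ℂ} {c : ℂ} (hL : Continuous L) (hz : Continuous z)
    (hre : ∀ t, 0 < (1 - z t).re) (he : ∀ t, exp (L t) = c * (1 - z t)) (s t : ℝ) :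
    (L t).im - (L s).im = arg (1 - z t) - arg (1 - z s) := by
  have hne : ∀ t, 1 - z t ≠ 0 := fun t h => by simpa [h] using hre t
  have hc : Continuous fun t => L t - log (1 - z t) :=
    hL.sub ((continuous_const.sub hz).clog fun t => Or.inl (hre t))
  have key : (fun t => L t - log (1 - z t)) = fun _ => L s - log (1 - z s) := by
    refine isCoveringMap_exp.eq_of_comp_eq hc continuous_const ?_ s rfl
    funext t
    simp only [Function.comp_apply, Subtype.mk.injEq, exp_sub, exp_log (hne _), he]
    rw [mul_div_cancel_right₀ _ (hne t), mul_div_cancel_right₀ _ (hne s)]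
  have h := congrArg Complex.im (congrFun key t)
  simp only [sub_im, log_im] at h
  linarith

theorem re_one_sub_pos {z : ℂ} (hz : ‖z‖ ≤ 1) (h1 : z ≠ 1) : 0 < (1 - z).re := by
  rw [sub_re, one_re, sub_pos]
  refine lt_of_le_of_ne ((re_le_norm z).trans hz) fun h => h1 ?_
  have h2 : ‖z‖ ^ 2 ≤ 1 := by nlinarith [norm_nonneg z]
  rw [← normSq_eq_norm_sq, normSq_apply] at h2
  apply Complex.ext <;> simp <;> nlinarith

/-- Two paths in the closed unit disc whose ends interleave on the unit circle meet. -/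
theorem exists_mem_range_of_interleaved {α β γ δ : ℝ} (h1 : α < β) (h2 : β < γ) (h3 : γ < δ)
    (h4 : δ < α + 2 * Real.pi)
    (p : Path (exp (α * I)) (exp (γ * I))) (q : Path (exp (β * I)) (exp (δ * I)))
    (hp : Set.range p ⊆ Metric.closedBall 0 1) (hq : Set.range q ⊆ Metric.closedBall 0 1) :
    (Set.range p ∩ Set.range q).Nonempty := by
  by_contra hcon
  rw [Set.not_nonempty_iff_eq_empty] at hcon
  have hdisj : ∀ s t : ℝ, p.extend s ≠ q.extend t := by
    intro s t h
    have hm : p.extend s ∈ Set.range p ∩ Set.range q := by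
      constructor
      · rw [← p.extend_range]; exact ⟨s, rfl⟩
      · rw [h, ← q.extend_range]; exact ⟨t, rfl⟩
    rw [hcon] at hm
    exact hm
  have hpn : ∀ s, ‖p.extend s‖ ≤ 1 := fun s => by
    have : p.extend s ∈ Set.range p := by rw [← p.extend_range]; exact ⟨s, rfl⟩
    simpa using hp this
  have hqn : ∀ s, ‖q.extend s‖ ≤ 1 := fun s => by
    have : q.extend s ∈ Set.range q := by rw [← q.extend_range]; exact ⟨s, rfl⟩
    simpa using hq this
  have hpc := p.continuous_extend
  have hqc := q.continuous_extend
  obtain ⟨L, hLc, hL⟩ : ∃ L : ℝ × ℝ → ℂ, Continuous L ∧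
      ∀ x, exp (L x) = p.extend x.1 - q.extend x.2 := by
    have hsc : IsSimplyConnected (Set.univ : Set (ℝ × ℝ)) := by
      have := (convex_univ (𝕜 := ℝ) (E := ℝ × ℝ)).contractibleSpace Set.univ_nonempty
      exact (inferInstance : SimplyConnectedSpace (Set.univ : Set (ℝ × ℝ)))
    obtain ⟨L, h1, h2⟩ := exists_continuousOn_eqOn_exp_comp hsc isOpen_univ
      (g := fun x : ℝ × ℝ => p.extend x.1 - q.extend x.2) (by fun_prop)
      (by rintro ⟨x, -, hx⟩; exact hdisj _ _ (sub_eq_zero.mp hx))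
    exact ⟨L, continuousOn_univ.mp h1, fun x => h2 (Set.mem_univ x)⟩
  have hinv : ∀ θ : ℝ, exp (θ * I) * exp (-θ * I) = 1 := fun θ => by rw [← exp_add]; simp
  have hn : ∀ θ : ℝ, ‖exp (-θ * I)‖ = 1 := fun θ => by
    rw [show (-θ * I : ℂ) = ((-θ : ℝ) : ℂ) * I by push_cast; ring, norm_exp_ofReal_mul_I]
  -- the increments of the logarithm along the four sides of the square
  have side1 : ∀ (θ : ℝ) (s0 : ℝ), p.extend s0 = exp (θ * I) → ∀ s t,
      (L (s0, t)).im - (L (s0, s)).im =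
        arg (1 - exp (-θ * I) * q.extend t) - arg (1 - exp (-θ * I) * q.extend s) := by
    intro θ s0 h0 s t
    refine im_log_increment (L := fun t => L (s0, t)) (z := fun t => exp (-θ * I) * q.extend t)
      (c := exp (θ * I)) (by fun_prop) (by fun_prop) (fun t => re_one_sub_pos ?_ ?_) ?_ s t
    · rw [norm_mul, hn, one_mul]; exact hqn t
    · intro h
      apply hdisj s0 t
      rw [h0]
      linear_combination (-exp (θ * I)) * h + q.extend t * hinv θ
    · intro t
      rw [hL, h0]
      linear_combination q.extend t * hinv θ
  have side2 : ∀ (θ : ℝ) (t0 : ℝ), q.extend t0 = exp (θ * I) → ∀ s t,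
      (L (t, t0)).im - (L (s, t0)).im =
        arg (1 - exp (-θ * I) * p.extend t) - arg (1 - exp (-θ * I) * p.extend s) := by
    intro θ t0 h0 s t
    refine im_log_increment (L := fun t => L (t, t0)) (z := fun t => exp (-θ * I) * p.extend t)
      (c := -exp (θ * I)) (by fun_prop) (by fun_prop) (fun t => re_one_sub_pos ?_ ?_) ?_ s t
    · rw [norm_mul, hn, one_mul]; exact hpn t
    · intro h
      apply hdisj t t0
      rw [h0]
      linear_combination (exp (θ * I)) * h - p.extend t * hinv θ
    · intro t
      rw [hL, h0]
      linear_combination (-p.extend t) * hinv θ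
  have e1 := side1 α 0 p.extend_zero 0 1
  have e2 := side1 γ 1 p.extend_one 0 1
  have e3 := side2 β 0 q.extend_zero 0 1
  have e4 := side2 δ 1 q.extend_one 0 1
  simp only [Path.extend_zero, Path.extend_one] at e1 e2 e3 e4
  have up : ∀ a b : ℝ, a < b → b < a + 2 * Real.pi →
      arg (1 - exp (-a * I) * exp (b * I)) = (b - a - Real.pi) / 2 := by
    intro a b hab hba
    rw [← exp_add, show (-a * I + b * I : ℂ) = ((b - a : ℝ) : ℂ) * I by push_cast; ring]
    exact arg_one_sub_exp (by linarith) (by linarith)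
  have down : ∀ a b : ℝ, b < a → a < b + 2 * Real.pi →
      arg (1 - exp (-a * I) * exp (b * I)) = (b - a + Real.pi) / 2 := by
    intro a b hab hba
    rw [← exp_add, show (-a * I + b * I : ℂ) = ((b - a + 2 * Real.pi : ℝ) : ℂ) * I +
      -(2 * Real.pi * I) by push_cast; ring, exp_add, exp_neg, exp_two_pi_mul_I, inv_one, mul_one,
      arg_one_sub_exp (by linarith) (by linarith)]
    ring
  rw [up α δ (by linarith) (by linarith), up α β (by linarith) (by linarith)] at e1
  rw [up γ δ (by linarith) (by linarith), down γ β (by linarith) (by linarith)] at e2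
  rw [up β γ (by linarith) (by linarith), down β α (by linarith) (by linarith)] at e3
  rw [down δ γ (by linarith) (by linarith), down δ α (by linarith) (by linarith)] at e4
  linarith [Real.pi_pos]

end Complex

/-! ### Outerplanar drawings as linear orders; counting chords -/

namespace SimpleGraph

variable {V : Type*} {G : SimpleGraph V}

/-- No two edges cross when the vertices are placed on a circle in the given linear order. -/
def NonCrossing [LinearOrder V] (G : SimpleGraph V) : Prop :=
  ∀ ⦃a b c d : V⦄, a < b → b < c → c < d → G.Adj a c → ¬ G.Adj b d

theorem OuterplanarDrawing.not_adj_of_arg_lt (D : G.OuterplanarDrawing) {a b c d : V}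
    (hab : (D.pos a).arg < (D.pos b).arg) (hbc : (D.pos b).arg < (D.pos c).arg)
    (hcd : (D.pos c).arg < (D.pos d).arg) (hac : G.Adj a c) : ¬ G.Adj b d := by
  intro hbd
  obtain ⟨p, -, hp⟩ := D.isArcBetween a c hac
  obtain ⟨q, -, hq⟩ := D.isArcBetween b d hbd
  have he : ∀ v, D.pos v = Complex.exp ((D.pos v).arg * Complex.I) := fun v => by
    conv_lhs => rw [← Complex.norm_mul_exp_arg_mul_I (D.pos v), D.norm_pos v]
    simp
  have hne : s(a, c) ≠ s(b, d) := by
    intro h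
    rcases Sym2.eq_iff.mp h with ⟨rfl, -⟩ | ⟨rfl, rfl⟩
    · exact lt_irrefl _ hab
    · exact lt_irrefl _ (hab.trans (hbc.trans hcd))
  obtain ⟨x, hx⟩ := Complex.exists_mem_range_of_interleaved hab hbc hcd
    (by linarith [Complex.arg_le_pi (D.pos d), Complex.neg_pi_lt_arg (D.pos a)])
    (p.cast (he a).symm (he c).symm) (q.cast (he b).symm (he d).symm)
    (by simpa [hp] using D.arc_subset s(a, c) hac)
    (by simpa [hq] using D.arc_subset s(b, d) hbd)
  have hx' : x ∈ D.arc s(a, c) ∩ D.arc s(b, d) := by simpa [hp, hq] using hx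
  obtain ⟨v, ⟨h1, h2⟩, -⟩ := D.arc_inter_subset _ hac _ hbd hne hx'
  rw [Sym2.mem_iff] at h1 h2
  rcases h1 with h1 | h1 <;> rcases h2 with h2 | h2 <;>
    have h := congrArg (fun v => (D.pos v).arg) (h1.symm.trans h2) <;> linarith

/-- If the removal of `j` leaves a connected graph, then a set separating two of the remaining
vertices is left by an edge that avoids `j`. -/
theorem exists_adj_of_induce_connected {j a b : V} (h : (G.induce {j}ᶜ).Connected) (X : Set V)
    (ha : a ≠ j) (hb : b ≠ j) (haX : a ∉ X) (hbX : b ∈ X) :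
    ∃ x ∈ X, ∃ y ∉ X, x ≠ j ∧ y ≠ j ∧ G.Adj x y := by
  obtain ⟨p⟩ := h.preconnected ⟨b, hb⟩ ⟨a, ha⟩
  obtain ⟨d, -, h1, h2⟩ := p.exists_boundary_dart (Subtype.val ⁻¹' X) hbX haX
  exact ⟨_, h1, _, h2, d.fst.2, d.snd.2, d.adj⟩

section Order

variable [Fintype V] [LinearOrder V]

/-- Cyclically consecutive vertices `a` and `b` of a two-connected graph without crossing edges are
adjacent, in the case that `b` has no smaller neighbours.  Otherwise let `j` be the largest
neighbour of `b`: after the removal of `j`, an edge has to leave `[b, j)`, but such an edge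
crosses `bj`. -/
theorem NonCrossing.adj_of_forall_adj_lt (hG : G.NonCrossing) (h2 : G.IsTwoConnected) {a b : V}
    (hab : a ≠ b) (hlt : ∀ x, G.Adj b x → b < x)
    (ha : (a < b ∧ ∀ x, x < b → x ≤ a) ∨ (∀ x, b ≤ x ∧ x ≤ a)) : G.Adj b a := by
  classical
  by_contra hna
  have : Nontrivial V := ⟨a, b, hab⟩
  obtain ⟨j, hj, hjmax⟩ := (G.neighborFinset b).exists_max_image id
    (by obtain ⟨x, hx⟩ := h2.2.1.preconnected.exists_adj_of_nontrivial b
        exact ⟨x, by simpa using hx⟩)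
  simp only [mem_neighborFinset, id] at hj hjmax
  have hbj := hlt j hj
  have haj : a ≠ j := by rintro rfl; exact hna hj
  obtain ⟨x, hx, y, hy, hxj, hyj, hxy⟩ := exists_adj_of_induce_connected (h2.2.2 j)
    (Set.Ico b j) haj hbj.ne (by
      rcases ha with ha | ha
      · exact fun h => absurd h.1 (not_le.mpr ha.1)
      · exact fun h => absurd h.2 (not_lt.mpr (ha j).2)) ⟨le_rfl, hbj⟩
  have hyb : y < b ∨ j < y := by
    by_contra! h
    exact hy ⟨h.1, lt_of_le_of_ne h.2 hyj⟩
  rcases hx.1.eq_or_lt with rfl | hbx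
  · rcases hyb with h | h
    · exact absurd (hlt y hxy) (not_lt.mpr h.le)
    · exact absurd (hjmax y hxy) (not_le.mpr h)
  · rcases hyb with h | h
    · exact hG h hbx hx.2 hxy.symm hj
    · exact hG hbx hx.2 h hj hxy

/-- If `b` has smaller neighbours, the largest of them plays the role that the largest neighbour
has in `NonCrossing.adj_of_forall_adj_lt`. -/
theorem NonCrossing.adj_of_covBy (hG : G.NonCrossing) (h2 : G.IsTwoConnected) {a b : V}
    (hab : a ⋖ b) : G.Adj a b := by
  classical
  by_contra hna
  by_cases hs : ∀ x, G.Adj b x → b < x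
  · exact hna (hG.adj_of_forall_adj_lt h2 hab.lt.ne hs
      (Or.inl ⟨hab.lt, fun x hx => hab.le_of_lt hx⟩)).symm
  push Not at hs
  obtain ⟨x0, hx0, hx0b⟩ := hs
  obtain ⟨j, hj, hjmax⟩ := ((G.neighborFinset b).filter (· < b)).exists_max_image id
    ⟨x0, by simpa using ⟨hx0, lt_of_le_of_ne hx0b hx0.ne'⟩⟩
  simp only [Finset.mem_filter, mem_neighborFinset, id, and_imp] at hj hjmax
  have haj : a ≠ j := by rintro rfl; exact hna hj.1.symm
  have hja : j < a := lt_of_le_of_ne (hab.le_of_lt hj.2) haj.symm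
  obtain ⟨x, hx, y, hy, hxj, hyj, hxy⟩ := exists_adj_of_induce_connected (h2.2.2 j)
    {x | b ≤ x ∨ x < j} haj hj.2.ne' (by
      rintro (h | h)
      · exact absurd h (not_le.mpr hab.lt)
      · exact absurd h (not_lt.mpr hja.le)) (Or.inl le_rfl)
  simp only [Set.mem_ofPred_eq, not_or, not_le, not_lt] at hx hy
  have hjy : j < y := lt_of_le_of_ne hy.2 hyj.symm
  rcases hx with hx | hx
  · rcases hx.eq_or_lt with rfl | hbx
    · exact absurd (hjmax y hxy hy.1) (not_le.mpr hjy)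
    · exact hG hjy hy.1 hbx hj.1.symm hxy.symm
  · exact hG hx hjy hy.1 hxy hj.1.symm

/-- The chords of the graph with both ends in `[u, v]`, as increasing pairs; only pairs
of consecutive vertices do not count as chords, so that the pair of the first and the last vertex
is included. -/
noncomputable def chordFinset (G : SimpleGraph V) (u v : V) : Finset (V × V) :=
  open Classical in {p | u ≤ p.1 ∧ p.1 < p.2 ∧ p.2 ≤ v ∧ G.Adj p.1 p.2 ∧ ¬ p.1 ⋖ p.2}

theorem mem_chordFinset {u v : V} {p : V × V} : p ∈ G.chordFinset u v ↔
    u ≤ p.1 ∧ p.1 < p.2 ∧ p.2 ≤ v ∧ G.Adj p.1 p.2 ∧ ¬ p.1 ⋖ p.2 := by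
  simp [chordFinset]

/-- Every chord has a private vertex below it, namely the largest neighbour of its left end that is
smaller than its right end. -/
theorem NonCrossing.card_chordFinset_le (hG : G.NonCrossing)
    (hc : ∀ a b : V, a ⋖ b → G.Adj a b) (u v : V) :
    (G.chordFinset u v).card ≤ {x | u < x ∧ x < v}.ncard := by
  classical
  have hex : ∀ p : V × V, p ∈ G.chordFinset u v → ∃ c, p.1 < c ∧ c < p.2 ∧ G.Adj p.1 c ∧
      ∀ x, G.Adj p.1 x → p.1 < x → x < p.2 → x ≤ c := by
    rintro ⟨a, b⟩ hp
    rw [mem_chordFinset] at hp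
    obtain ⟨-, hab, -, -, hn⟩ := hp
    simp only at hab hn ⊢
    obtain ⟨c, hc', hcm⟩ := (Finset.univ.filter fun x => a < x ∧ x < b ∧ G.Adj a x).exists_max_image
      id (by
        obtain ⟨m, hm, hmm⟩ := (Finset.univ.filter fun x => a < x).exists_min_image id ⟨b, by simpa⟩
        simp only [Finset.mem_filter, Finset.mem_univ, true_and, id] at hm hmm
        have ham : a ⋖ m := ⟨hm, fun x hx hxm => absurd (hmm x hx) (not_le.mpr hxm)⟩
        refine ⟨m, ?_⟩
        simp only [Finset.mem_filter, Finset.mem_univ, true_and]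
        refine ⟨hm, lt_of_le_of_ne (hmm b hab) ?_, hc _ _ ham⟩
        rintro rfl; exact hn ham)
    simp only [Finset.mem_filter, Finset.mem_univ, true_and, id, and_imp] at hc' hcm
    exact ⟨c, hc'.1, hc'.2.1, hc'.2.2, fun x h1 h2 h3 => hcm x h2 h3 h1⟩
  have : Nonempty V := ⟨u⟩
  choose! g h1 h2 h3 h4 using hex
  rw [Set.ncard_eq_toFinset_card']
  refine Finset.card_le_card_of_injOn g ?_ ?_
  · intro p hp
    have hp' := mem_chordFinset.mp hp
    simpa using ⟨hp'.1.trans_lt (h1 p hp), (h2 p hp).trans_le hp'.2.2.1⟩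
  · have key : ∀ p ∈ G.chordFinset u v, ∀ q ∈ G.chordFinset u v, g p = g q → ¬ p.1 < q.1 := by
      intro p hp q hq h hlt
      exact hG hlt (h ▸ h1 q hq) (h ▸ h2 q hq) (h3 p hp) (mem_chordFinset.mp hq).2.2.2.1
    have key2 : ∀ p ∈ G.chordFinset u v, ∀ q ∈ G.chordFinset u v, g p = g q → p.1 = q.1 →
        ¬ p.2 < q.2 := by
      intro p hp q hq h h' hlt
      have hp' := mem_chordFinset.mp hp
      have := h4 q hq p.2 (h' ▸ hp'.2.2.2.1) (h' ▸ hp'.2.1) hlt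
      exact absurd (h2 p hp) (not_lt.mpr (h ▸ this))
    intro p hp q hq h
    have e1 : p.1 = q.1 :=
      le_antisymm (not_lt.mp (key q hq p hp h.symm)) (not_lt.mp (key p hp q hq h))
    exact Prod.ext e1 (le_antisymm (not_lt.mp (key2 q hq p hp h.symm e1.symm))
      (not_lt.mp (key2 p hp q hq h e1)))

end Order

/-- A Hamiltonian cycle of a graph with `n` vertices and `m` edges has `m - n` chords. -/
theorem Walk.IsHamiltonianCycle.ncard_isChord [Fintype V] [DecidableEq V] {v : V} {C : G.Walk v v}
    (hC : C.IsHamiltonianCycle) : {e | C.IsChord e}.ncard + Fintype.card V = G.edgeSet.ncard := by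
  classical
  have h1 : {e | C.IsChord e} = G.edgeSet \ (C.edges.toFinset : Set (Sym2 V)) := by
    ext e
    induction e with | h x y
    simp [Walk.isChord_sym2Mk, hC.mem_support]
  have h2 : (C.edges.toFinset : Set (Sym2 V)) ⊆ G.edgeSet := by
    intro e he
    exact C.edges_subset_edgeSet (by simpa using he)
  have h3 : (C.edges.toFinset : Set (Sym2 V)).ncard = Fintype.card V := by
    rw [Set.ncard_coe_finset, List.toFinset_card_of_nodup hC.isCycle.edges_nodup,
      Walk.length_edges, hC.length_eq]
  rw [h1, ← h3, Set.ncard_sdiff_add_ncard_of_subset h2]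

section Order

variable [Fintype V] [LinearOrder V]

theorem exists_isHamiltonianCycle (h3 : 3 ≤ Fintype.card V)
    (hc : ∀ a b : V, a ⋖ b → G.Adj a b) (ht : ∀ a b : V, (∀ x, a ≤ x) → (∀ x, x ≤ b) → G.Adj a b) :
    ∃ (v : V) (C : G.Walk v v), C.IsHamiltonianCycle := by
  obtain ⟨n, hn⟩ : ∃ n, Fintype.card V = n + 3 := ⟨_, (Nat.sub_add_cancel h3).symm⟩
  let e : Fin (n + 3) ≃o V := Fintype.orderIsoFinOfCardEq V hn
  have key : ∀ i : Fin (n + 3), G.Adj (e i) (e (i + 1)) := by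
    intro i
    by_cases hi : i = Fin.last _
    · subst hi
      rw [Fin.last_add_one]
      refine (ht _ _ (fun x => ?_) (fun x => ?_)).symm
      · rw [← e.apply_symm_apply x, e.le_iff_le]; exact Fin.zero_le _
      · rw [← e.apply_symm_apply x, e.le_iff_le]; exact Fin.le_last _
    · apply hc
      rw [apply_covBy_apply_iff]
      rw [Fin.covBy_iff, Nat.covBy_iff_add_one_eq, Fin.val_add_one, if_neg hi]
  let f : cycleGraph (n + 3) →g G := ⟨e, by
    intro a b hab
    rw [cycleGraph_adj] at hab
    rcases hab with h | h
    · rw [show a = b + 1 by rw [← h]; abel]; exact (key b).symm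
    · rw [show b = a + 1 by rw [← h]; abel]; exact key a⟩
  refine ⟨_, (cycleGraph.cycle n).map f, ?_⟩
  rw [Walk.isHamiltonianCycle_iff_isCycle_and_length_eq]
  refine ⟨(Walk.isCycle_map_iff_of_injective e.injective).mpr cycleGraph.isCycle_cycle, ?_⟩
  rw [Walk.length_map, cycleGraph.length_cycle, hn]

/-- In a linear order with `n` elements there are `n - 1` pairs of consecutive elements, and the
other edges of the graph are the chords. -/
theorem card_chordFinset_add_le (hc : ∀ a b : V, a ⋖ b → G.Adj a b) (u v : V) :
    (G.chordFinset u v).card + Fintype.card V ≤ G.edgeSet.ncard + 1 := by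
  classical
  have hsucc : ∀ a : V, (∃ b, a < b) → ∃ b, a ⋖ b := by
    rintro a ⟨b, hb⟩
    obtain ⟨m, hm, hmm⟩ := (Finset.univ.filter fun x => a < x).exists_min_image id ⟨b, by simpa⟩
    simp only [Finset.mem_filter, Finset.mem_univ, true_and, id] at hm hmm
    exact ⟨m, hm, fun x hx hxm => absurd (hmm x hx) (not_le.mpr hxm)⟩
  choose! s hs using hsucc
  let A : Finset V := Finset.univ.filter fun a => ∃ b, a < b
  have hA : Fintype.card V ≤ A.card + 1 := by
    have : (Finset.univ \ A).card ≤ 1 := by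
      rw [Finset.card_le_one]
      intro x hx y hy
      simp only [A, Finset.mem_sdiff, Finset.mem_univ, true_and, Finset.mem_filter, not_exists,
        not_lt] at hx hy
      exact le_antisymm (hy x) (hx y)
    have h := Finset.card_sdiff_add_card_eq_card (Finset.subset_univ A)
    rw [Finset.card_univ] at h
    omega
  let B : Finset (V × V) := A.image fun a => (a, s a)
  have hB : B.card = A.card := Finset.card_image_of_injective _ fun a b h => (Prod.ext_iff.mp h).1
  have hBm : ∀ p ∈ B, p.1 ⋖ p.2 := by
    intro p hp
    obtain ⟨a, ha, rfl⟩ := Finset.mem_image.mp hp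
    exact hs a (by simpa [A] using ha)
  have hd : Disjoint (G.chordFinset u v) B := by
    rw [Finset.disjoint_left]
    intro p hp hpB
    exact (mem_chordFinset.mp hp).2.2.2.2 (hBm p hpB)
  have hle : ∀ p ∈ G.chordFinset u v ∪ B, p.1 < p.2 ∧ G.Adj p.1 p.2 := by
    intro p hp
    rcases Finset.mem_union.mp hp with hp | hp
    · exact ⟨(mem_chordFinset.mp hp).2.1, (mem_chordFinset.mp hp).2.2.2.1⟩
    · exact ⟨(hBm p hp).lt, hc _ _ (hBm p hp)⟩
  have hE : (G.chordFinset u v ∪ B).card ≤ G.edgeSet.ncard := by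
    rw [Set.ncard_eq_toFinset_card']
    refine Finset.card_le_card_of_injOn (fun p => s(p.1, p.2)) ?_ ?_
    · intro p hp
      simpa using (hle p hp).2
    · intro p hp q hq h
      rcases Sym2.eq_iff.mp h with ⟨h1, h2⟩ | ⟨h1, h2⟩
      · exact Prod.ext h1 h2
      · have a1 := (hle p hp).1
        have a2 := (hle q hq).1
        rw [h1, h2] at a1
        exact absurd a1 (not_lt.mpr a2.le)
  rw [Finset.card_union_of_disjoint hd, hB] at hE
  omega

end Order

end SimpleGraph

/-! ### The localization game in terms of sets of possible positions -/

namespace SimpleGraph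

variable {V : Type*} {G : SimpleGraph V}

/-- The vertices that the robber can reach from `S` with one move. -/
def reach (G : SimpleGraph V) (S : Set V) : Set V :=
  {x | ∃ y ∈ S, x = y ∨ G.Adj y x}

/-- The positions in `S` that a probe of `p` and `q` does not distinguish from `x`. -/
def probeClass (G : SimpleGraph V) (S : Set V) (p q x : V) : Set V :=
  {y ∈ S | G.dist p y = G.dist p x ∧ G.dist q y = G.dist q x}

/-- Two cops that know the robber to be in `S` just before their next probe can locate him within
`m` more probes. The knowledge carried to the next round is the set of the vertices that the
robber can reach from the positions consistent with the last answer. -/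
def Wins (G : SimpleGraph V) : ℕ → Set V → Prop
  | 0, S => S = ∅
  | m + 1, S => ∃ p q, ∀ x ∈ S,
      G.probeClass S p q x ⊆ {x} ∨ Wins G m (G.reach (G.probeClass S p q x))

theorem reach_mono {S T : Set V} (h : S ⊆ T) : G.reach S ⊆ G.reach T :=
  fun _ ⟨y, hy, hxy⟩ => ⟨y, h hy, hxy⟩

theorem mem_probeClass_self {S : Set V} {p q x : V} (hx : x ∈ S) : x ∈ G.probeClass S p q x :=
  ⟨hx, rfl, rfl⟩

theorem Wins.mono {m : ℕ} {S T : Set V} (h : G.Wins m T) (hST : S ⊆ T) : G.Wins m S := by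
  induction m generalizing S T with
  | zero => exact Set.subset_empty_iff.mp (h.symm ▸ hST : S ⊆ ∅)
  | succ m ih =>
    obtain ⟨p, q, hpq⟩ := h
    refine ⟨p, q, fun x hx => ?_⟩
    have hsub : G.probeClass S p q x ⊆ G.probeClass T p q x := fun y hy => ⟨hST hy.1, hy.2⟩
    exact (hpq x (hST hx)).imp hsub.trans fun h => ih h (reach_mono hsub)

theorem Wins.succ [Nonempty V] {m : ℕ} {S : Set V} (h : G.Wins m S) : G.Wins (m + 1) S := by
  induction m generalizing S with
  | zero =>
    obtain ⟨v⟩ := ‹Nonempty V›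
    subst h
    exact ⟨v, v, fun x hx => hx.elim⟩
  | succ m ih =>
    obtain ⟨p, q, hpq⟩ := h
    exact ⟨p, q, fun x hx => (hpq x hx).imp_right ih⟩

theorem Wins.le [Nonempty V] {m n : ℕ} {S : Set V} (h : G.Wins m S) (hmn : m ≤ n) :
    G.Wins n S := by
  induction hmn with
  | refl => exact h
  | step _ ih => exact ih.succ

theorem Wins.of_subsingleton [Nonempty V] {m : ℕ} (hm : 1 ≤ m) {S : Set V} (h : S.Subsingleton) :
    G.Wins m S := by
  obtain ⟨v⟩ := ‹Nonempty V›
  exact Wins.le (m := 1) ⟨v, v, fun x hx => Or.inl fun y hy => h hy.1 hx⟩ hm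

/-- It suffices to treat every class of answers that contains two different vertices. -/
theorem Wins.of_probe {m : ℕ} (hm : 1 ≤ m) {S : Set V} (p q : V)
    (h : ∀ x ∈ S, G.probeClass S p q x ⊆ {x} ∨ G.Wins (m - 1) (G.reach (G.probeClass S p q x))) :
    G.Wins m S := by
  obtain ⟨m, rfl⟩ := Nat.exists_eq_add_of_le' hm
  exact ⟨p, q, h⟩

/-- The first answer can be split off: afterwards the cops follow the strategy that results from
fixing the first entry of the list of answers. -/
theorem answers_succ_eq_cons {k : ℕ} (σ : CopStrategy V k) (r : ℕ → V) (t : ℕ) :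
    answers G σ r (t + 1) = (fun i => G.dist (σ [] i) (r 0)) ::
      answers G (fun l => σ ((fun i => G.dist (σ [] i) (r 0)) :: l)) (fun s => r (s + 1)) t := by
  induction t with
  | zero => simp [answers]
  | succ t ih =>
    rw [answers, ih]
    simp only [List.cons_append, answers]

theorem Wins.exists_strategy [Nonempty V] {m : ℕ} {S : Set V} (h : G.Wins m S) :
    ∃ σ : CopStrategy V 2, ∀ r : ℕ → V, G.IsRobberTrajectory r → r 0 ∈ S →
      ∃ t < m, ∀ r' : ℕ → V, G.IsRobberTrajectory r' → r' 0 ∈ S →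
        answers G σ r' (t + 1) = answers G σ r (t + 1) → r' t = r t := by
  classical
  induction m generalizing S with
  | zero =>
    subst h
    exact ⟨fun _ _ => Classical.arbitrary V, fun r _ h => h.elim⟩
  | succ m ih =>
    obtain ⟨p, q, hpq⟩ := h
    let pr : Fin 2 → V := ![p, q]
    -- the set of positions consistent with an answer, and a strategy for the time after it
    let C : (Fin 2 → ℕ) → Set V := fun a => {y ∈ S | G.dist p y = a 0 ∧ G.dist q y = a 1}
    have hex : ∀ a, ∃ τ : CopStrategy V 2, G.Wins m (G.reach (C a)) →
        ∀ r : ℕ → V, G.IsRobberTrajectory r → r 0 ∈ G.reach (C a) →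
        ∃ t < m, ∀ r' : ℕ → V, G.IsRobberTrajectory r' → r' 0 ∈ G.reach (C a) →
        answers G τ r' (t + 1) = answers G τ r (t + 1) → r' t = r t := by
      intro a
      by_cases ha : G.Wins m (G.reach (C a))
      · obtain ⟨τ, hτ⟩ := ih ha
        exact ⟨τ, fun _ => hτ⟩
      · exact ⟨fun _ _ => Classical.arbitrary V, fun h => absurd h ha⟩
    choose τ hτ using hex
    let σ : CopStrategy V 2 := fun l => match l with
      | [] => pr
      | a :: l => τ a l
    refine ⟨σ, fun r hr hr0 => ?_⟩
    have hC : ∀ r' : ℕ → V, r' 0 ∈ S → ∀ t, answers G σ r' (t + 1) = answers G σ r (t + 1) →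
        r' 0 ∈ G.probeClass S p q (r 0) ∧
        answers G (τ fun i => G.dist (pr i) (r 0)) (fun s => r' (s + 1)) t =
        answers G (τ fun i => G.dist (pr i) (r 0)) (fun s => r (s + 1)) t := by
      intro r' h0 t h
      rw [answers_succ_eq_cons, answers_succ_eq_cons] at h
      simp only [List.cons.injEq] at h
      obtain ⟨h1, h2⟩ := h
      have h1' : (fun i => G.dist (pr i) (r' 0)) = fun i => G.dist (pr i) (r 0) := h1
      refine ⟨⟨h0, congrFun h1' 0, congrFun h1' 1⟩, ?_⟩
      rw [h1] at h2
      exact h2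
    rcases hpq (r 0) hr0 with hs | hw
    · exact ⟨0, Nat.succ_pos m, fun r' _ hr0' h => hs (hC r' hr0' 0 h).1⟩
    · obtain ⟨t, htm, ht⟩ := hτ (fun i => G.dist (pr i) (r 0)) hw (fun s => r (s + 1))
        (fun s => hr (s + 1)) ⟨r 0, mem_probeClass_self hr0, hr 0⟩
      refine ⟨t + 1, Nat.succ_lt_succ htm, fun r' hr' hr0' h => ?_⟩
      obtain ⟨h1, h2⟩ := hC r' hr0' (t + 1) h
      exact ht (fun s => r' (s + 1)) (fun s => hr' (s + 1)) ⟨r' 0, h1, hr' 0⟩ h2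

theorem Wins.copsLocateWithin [Nonempty V] {m : ℕ} (h : G.Wins m Set.univ) :
    G.CopsLocateWithin 2 m := by
  obtain ⟨σ, hσ⟩ := h.exists_strategy
  refine ⟨σ, fun r hr => ?_⟩
  obtain ⟨t, ht, h⟩ := hσ r hr (Set.mem_univ _)
  exact ⟨t, ht, fun r' hr' => h r' hr' (Set.mem_univ _)⟩

end SimpleGraph

/-! ### Faces -/

namespace SimpleGraph

variable {V : Type*} {G : SimpleGraph V} [LinearOrder V]

/-- The linear order cuts open an outer cycle of the connected graph `G`: no two edges cross, and
consecutive vertices are adjacent. -/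
structure IsOuterOrder (G : SimpleGraph V) : Prop where
  nonCrossing : G.NonCrossing
  connected : G.Connected
  adj_of_covBy : ∀ a b : V, a ⋖ b → G.Adj a b

omit [LinearOrder V] in
theorem Connected.dist_le_succ {G : SimpleGraph V} (hG : G.Connected) {a b : V} (h : G.Adj a b)
    (c : V) : G.dist c b ≤ G.dist c a + 1 := by
  have h1 := hG.dist_triangle (u := c) (v := a) (w := b)
  rwa [dist_eq_one_iff_adj.mpr h] at h1

theorem NonCrossing.not_adj_of_mem_Ioo (hG : G.NonCrossing) {u v a b : V} (huv : G.Adj u v)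
    (ha : a ∉ Set.Icc u v) (hb : b ∈ Set.Ioo u v) : ¬ G.Adj a b := by
  intro h
  by_cases hau : u ≤ a
  · exact hG hb.1 hb.2 (not_le.mp fun hv => ha ⟨hau, hv⟩) huv h.symm
  · exact hG (not_le.mp hau) hb.1 hb.2 h huv

theorem NonCrossing.reach_Ioo (hG : G.NonCrossing) {u v : V} (huv : G.Adj u v) {S : Set V}
    (hS : S ⊆ Set.Ioo u v) : G.reach S ⊆ Set.Icc u v := by
  rintro x ⟨y, hy, rfl | h⟩
  · exact Set.Ioo_subset_Icc_self (hS hy)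
  · by_contra hx
    exact hG.not_adj_of_mem_Ioo huv hx (hS hy) h.symm

/-- An edge `uv` separates the vertices between `u` and `v` from the others. -/
theorem NonCrossing.exists_mem_support (hG : G.NonCrossing) {u v q x : V} (huv : G.Adj u v)
    (hx : x ∈ Set.Icc u v) (hq : q ∉ Set.Ioo u v) (p : G.Walk q x) :
    u ∈ p.support ∨ v ∈ p.support := by
  induction p with
  | nil =>
    by_contra! h
    simp only [Walk.support_nil, List.mem_singleton] at h
    exact hq ⟨lt_of_le_of_ne hx.1 h.1, lt_of_le_of_ne hx.2 (Ne.symm h.2)⟩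
  | @cons a b c hab p ih =>
    by_cases ha : a = u ∨ a = v
    · rcases ha with rfl | rfl <;> simp
    · push Not at ha
      have hb : b ∉ Set.Ioo u v := fun hb => hG.not_adj_of_mem_Ioo huv
        (fun h => hq ⟨lt_of_le_of_ne h.1 ha.1.symm, lt_of_le_of_ne h.2 ha.2⟩) hb hab
      rw [Walk.support_cons]
      exact (ih hx hb).imp (List.mem_cons_of_mem _) (List.mem_cons_of_mem _)

theorem IsOuterOrder.dist_eq_min (hG : G.IsOuterOrder) {u v q x : V} (huv : G.Adj u v)
    (hx : x ∈ Set.Icc u v) (hq : q ∉ Set.Ioo u v) :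
    G.dist q x = min (G.dist q u + G.dist u x) (G.dist q v + G.dist v x) := by
  apply le_antisymm
  · exact le_min hG.connected.dist_triangle hG.connected.dist_triangle
  · obtain ⟨p, hp⟩ := hG.connected.exists_walk_length_eq_dist q x
    have key : ∀ s ∈ p.support, G.dist q s + G.dist s x ≤ G.dist q x := by
      classical
      intro s hs
      rw [← hp, ← congrArg Walk.length (p.take_spec hs), Walk.length_append]
      exact add_le_add (dist_le _) (dist_le _)
    rcases hG.nonCrossing.exists_mem_support huv hx hq p with h | h
    · exact (min_le_left _ _).trans (key _ h)
    · exact (min_le_right _ _).trans (key _ h)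

/-- The inner face below the edge `uv`: its vertices are `w 0 = u < w 1 < ⋯ < w k = v`.  It is
characterized by the property that every other edge with both ends in `[u, v]` lies between two
consecutive vertices of the face. -/
structure IsFace (G : SimpleGraph V) (u v : V) (k : ℕ) (w : ℕ → V) : Prop where
  zero : w 0 = u
  last : w k = v
  two_le : 2 ≤ k
  adj_ends : G.Adj u v
  lt_succ : ∀ i < k, w i < w (i + 1)
  adj : ∀ i < k, G.Adj (w i) (w (i + 1))
  edge : ∀ a b, u ≤ a → a < b → b ≤ v → G.Adj a b →
    (a = u ∧ b = v) ∨ ∃ i < k, w i ≤ a ∧ b ≤ w (i + 1)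

theorem exists_le_lt_succ {w : ℕ → V} {k : ℕ} {x : V} (h0 : w 0 ≤ x) (hk : x < w k) :
    ∃ i < k, w i ≤ x ∧ x < w (i + 1) := by
  induction k with
  | zero => exact absurd h0 (not_le.mpr hk)
  | succ k ih =>
    by_cases h : x < w k
    · obtain ⟨i, hi, h⟩ := ih h
      exact ⟨i, by omega, h⟩
    · exact ⟨k, by omega, not_lt.mp h, hk⟩

/-- The vertices of the face are found greedily, by passing from each vertex to its largest
neighbour in `[u, v]`, where the edge `uv` itself is not used. -/
theorem IsOuterOrder.exists_isFace [Finite V] (hG : G.IsOuterOrder) {u v : V} (huv : u < v)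
    (ha : G.Adj u v) (hn : ¬ u ⋖ v) : ∃ k w, G.IsFace u v k w := by
  classical
  have := Fintype.ofFinite V
  have hex : ∀ a, u ≤ a → a < v → ∃ b, a < b ∧ b ≤ v ∧ G.Adj a b ∧ ¬ (a = u ∧ b = v) ∧
      ∀ c, G.Adj a c → a < c → c ≤ v → ¬ (a = u ∧ c = v) → c ≤ b := by
    intro a hua hav
    obtain ⟨m, hm, hmm⟩ := (Finset.univ.filter fun x => a < x).exists_min_image id ⟨v, by simpa⟩
    simp only [Finset.mem_filter, Finset.mem_univ, true_and, id] at hm hmm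
    have ham : a ⋖ m := ⟨hm, fun x hx hxm => absurd (hmm x hx) (not_le.mpr hxm)⟩
    obtain ⟨b, hb, hbm⟩ := (Finset.univ.filter fun x => a < x ∧ x ≤ v ∧ G.Adj a x ∧
      ¬ (a = u ∧ x = v)).exists_max_image id ⟨m, by
        simp only [Finset.mem_filter, Finset.mem_univ, true_and]
        refine ⟨hm, hmm v hav, hG.adj_of_covBy _ _ ham, ?_⟩
        rintro ⟨rfl, rfl⟩
        exact hn ham⟩
    simp only [Finset.mem_filter, Finset.mem_univ, true_and, id] at hb hbm
    exact ⟨b, hb.1, hb.2.1, hb.2.2.1, hb.2.2.2, fun c h1 h2 h3 h4 => hbm c ⟨h2, h3, h1, h4⟩⟩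
  have : Nonempty V := ⟨u⟩
  choose! s h1 h2 h3 h4 h5 using hex
  have hfin : ∀ a, u ≤ a → a ≤ v → ∃ j, s^[j] a = v := by
    intro a
    induction a using WellFoundedGT.induction with
    | ind a ih =>
      intro hua hav
      rcases hav.eq_or_lt with rfl | hav
      · exact ⟨0, rfl⟩
      · obtain ⟨j, hj⟩ := ih (s a) (h1 a hua hav) (hua.trans (h1 a hua hav).le) (h2 a hua hav)
        exact ⟨j + 1, hj⟩
  have hj := hfin u le_rfl huv.le
  let k := Nat.find hj
  let w : ℕ → V := fun j => s^[j] u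
  have hwk : w k = v := Nat.find_spec hj
  have hws : ∀ i, w (i + 1) = s (w i) := fun i => Function.iterate_succ_apply' s i u
  have hw : ∀ i ≤ k, u ≤ w i ∧ w i ≤ v := by
    intro i
    induction i with
    | zero => exact fun _ => ⟨le_rfl, huv.le⟩
    | succ i ih =>
      intro hi
      have hlt : w i < v := lt_of_le_of_ne (ih (by omega)).2 (Nat.find_min hj (by omega : i < k))
      rw [hws]
      exact ⟨(ih (by omega)).1.trans (h1 _ (ih (by omega)).1 hlt).le, h2 _ (ih (by omega)).1 hlt⟩
  have hwl : ∀ i < k, u ≤ w i ∧ w i < v := fun i hi =>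
    ⟨(hw i hi.le).1, lt_of_le_of_ne (hw i hi.le).2 (Nat.find_min hj hi)⟩
  refine ⟨k, w, rfl, hwk, ?_, ha, fun i hi => ?_, fun i hi => ?_, ?_⟩
  · by_contra hk
    have h0 : k ≠ 0 := fun h => huv.ne (by rw [← hwk, h]; rfl)
    have hk1 : k = 1 := by omega
    refine h4 u le_rfl huv ⟨rfl, ?_⟩
    rw [← hwk, hk1]
    rfl
  · rw [hws]; exact h1 _ (hwl i hi).1 (hwl i hi).2
  · rw [hws]; exact h3 _ (hwl i hi).1 (hwl i hi).2
  · intro a b hua hab hbv hadj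
    by_cases hc : a = u ∧ b = v
    · exact Or.inl hc
    right
    obtain ⟨i, hi, hia, hai⟩ := exists_le_lt_succ (w := w) (k := k) hua
      (by rw [hwk]; exact hab.trans_le hbv)
    refine ⟨i, hi, hia, not_lt.mp fun hb => ?_⟩
    have h := hwl i hi
    rcases hia.eq_or_lt with rfl | hia
    · exact absurd (h5 _ h.1 h.2 b hadj hab hbv hc) (not_le.mpr (hws i ▸ hb))
    · exact hG.nonCrossing hia hai hb (hws i ▸ h3 _ h.1 h.2) hadj

namespace IsFace

variable {u v : V} {k : ℕ} {w : ℕ → V}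

theorem le_of_le (h : G.IsFace u v k w) {i j : ℕ} (hij : i ≤ j) (hj : j ≤ k) : w i ≤ w j := by
  induction hij with
  | refl => exact le_rfl
  | step _ ih => exact (ih (by omega)).trans (h.lt_succ _ (by omega)).le

theorem lt_of_lt (h : G.IsFace u v k w) {i j : ℕ} (hij : i < j) (hj : j ≤ k) : w i < w j :=
  (h.lt_succ i (by omega)).trans_le (h.le_of_le hij hj)

theorem lt_of_apply_lt (h : G.IsFace u v k w) {i j : ℕ} (hi : i ≤ k) (hij : w i < w j) : i < j := by
  by_contra hn
  exact absurd (h.le_of_le (not_lt.mp hn) hi) (not_le.mpr hij)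

theorem ends_lt (h : G.IsFace u v k w) : u < v := by
  rw [← h.zero, ← h.last]
  exact h.lt_of_lt (by have := h.two_le; omega) le_rfl

theorem mem_Icc (h : G.IsFace u v k w) {i : ℕ} (hi : i ≤ k) : w i ∈ Set.Icc u v := by
  rw [← h.zero, ← h.last]
  exact ⟨h.le_of_le (Nat.zero_le _) hi, h.le_of_le hi le_rfl⟩

theorem notMem_Ioo (h : G.IsFace u v k w) {i j : ℕ} (hi : i < k) (hj : j ≤ k) :
    w j ∉ Set.Ioo (w i) (w (i + 1)) := by
  rintro ⟨h1, h2⟩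
  have := h.lt_of_apply_lt hi.le h1
  have := h.lt_of_apply_lt hj h2
  omega

/-- The distance of two vertices of a face is their distance along the boundary of the face: the
map that sends the vertices `x` with `w i ≤ x < w (i + 1)` to `i`, everything below `u` to `0` and
everything above `v` to `k` retracts the graph to a cycle of length `k + 1`. -/
theorem dist_apply (h : G.IsFace u v k w) (hG : G.IsOuterOrder) {i j : ℕ} (hij : i ≤ j)
    (hj : j ≤ k) : G.dist (w i) (w j) = min (j - i) (i + k + 1 - j) := by
  classical
  have hpath : ∀ a b, a ≤ b → b ≤ k → G.dist (w a) (w b) ≤ b - a := by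
    intro a b
    induction b with
    | zero => intro hab _; simp [Nat.le_zero.mp hab]
    | succ b ih =>
      intro hab hb
      rcases Nat.lt_or_ge b a with h1 | h1
      · simp [show a = b + 1 by omega]
      · have h2 := hG.connected.dist_le_succ (h.adj b (by omega)) (w a)
        have h3 := ih h1 (by omega)
        omega
  apply le_antisymm
  · refine le_min (hpath i j hij hj) ?_
    have h1 := hpath 0 i (Nat.zero_le _) (by omega)
    have h2 := hpath j k hj le_rfl
    have h3 := hG.connected.dist_le_succ h.adj_ends (w i)
    have h4 := hG.connected.dist_triangle (u := w i) (v := v) (w := w j)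
    rw [h.zero, dist_comm] at h1
    rw [h.last, dist_comm] at h2
    omega
  · let ρ : V → ℕ := fun x => Nat.findGreatest (fun m => w m ≤ x) k
    have hρk : ∀ x, ρ x ≤ k := fun x => Nat.findGreatest_le k
    have hρle : ∀ x m, m ≤ k → w m ≤ x → m ≤ ρ x := fun x m hm hx => Nat.le_findGreatest hm hx
    have hρlt : ∀ x m, m ≤ k → x < w m → ρ x < m ∨ ρ x = 0 := by
      intro x m hm hx
      by_contra! hcon
      have hs : w (ρ x) ≤ x := Nat.findGreatest_of_ne_zero (P := fun m => w m ≤ x) rfl hcon.2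
      exact absurd (h.le_of_le hcon.1 (hρk x)) (not_le.mpr (hs.trans_lt hx))
    have hρw : ∀ m ≤ k, ρ (w m) = m := by
      intro m hm
      apply le_antisymm _ (hρle _ m hm le_rfl)
      by_contra hcon
      have h0 : ρ (w m) ≠ 0 := by omega
      have hs : w (ρ (w m)) ≤ w m :=
        Nat.findGreatest_of_ne_zero (P := fun n => w n ≤ w m) rfl h0
      exact absurd (h.lt_of_lt (not_le.mp hcon) (hρk _)) (not_lt.mpr hs)
    -- adjacent vertices are sent to equal or cyclically consecutive indices
    have hstep : ∀ a b, a < b → G.Adj a b → ρ b ≤ ρ a + 1 ∧ ρ a ≤ ρ b ∨ ρ a = 0 ∧ ρ b = k := by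
      intro a b hab hadj
      have hmono : ρ a ≤ ρ b := Nat.findGreatest_mono_left (fun m hm => hm.trans hab.le) k
      have hsmall : ∀ x, x ≤ u → ρ x = 0 := by
        intro x hx
        have := hρlt x 1 (by have := h.two_le; omega)
          (hx.trans_lt (by rw [← h.zero]; exact h.lt_succ 0 (by have := h.two_le; omega)))
        omega
      have hbig : ∀ x, v ≤ x → ρ x = k :=
        fun x hx => le_antisymm (hρk x) (hρle x k le_rfl (by rw [h.last]; exact hx))
      by_cases hua : u ≤ a
      · by_cases hbv : b ≤ v
        · rcases h.edge a b hua hab hbv hadj with ⟨rfl, rfl⟩ | ⟨m, hm, hma, hmb⟩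
          · exact Or.inr ⟨hsmall _ le_rfl, hbig _ le_rfl⟩
          · left
            have h1 := hρle a m hm.le hma
            have h2 : ρ b ≤ m + 1 := by
              rw [← hρw (m + 1) hm]
              exact Nat.findGreatest_mono_left (fun n hn => hn.trans hmb) k
            omega
        · rcases hua.eq_or_lt with rfl | hua
          · exact Or.inr ⟨hsmall _ le_rfl, hbig _ (not_le.mp hbv).le⟩
          · have hva : v ≤ a := by
              by_contra hav
              exact hG.nonCrossing hua (not_le.mp hav) (not_le.mp hbv) h.adj_ends hadj
            have := hbig a hva
            have := hbig b (hva.trans hab.le)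
            omega
      · have hau := not_le.mp hua
        have h0 := hsmall a hau.le
        by_cases hbu : b ≤ u
        · have := hsmall b hbu
          omega
        · have hvb : v ≤ b := by
            by_contra hbv
            exact hG.nonCrossing hau (not_le.mp hbu) (not_le.mp hbv) hadj h.adj_ends
          exact Or.inr ⟨h0, hbig b hvb⟩
    have hstep' : ∀ a b, G.Adj a b → ρ b ≤ ρ a + 1 ∧ ρ a ≤ ρ b + 1 ∨ ρ a = 0 ∧ ρ b = k ∨
        ρ b = 0 ∧ ρ a = k := by
      intro a b hadj
      rcases lt_or_gt_of_ne hadj.ne with hab | hab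
      · have := hstep a b hab hadj
        omega
      · have := hstep b a hab hadj.symm
        omega
    have hwalk : ∀ (a b : V) (p : G.Walk a b), ∀ c ≤ k,
        min (max c (ρ b) - min c (ρ b)) (min c (ρ b) + k + 1 - max c (ρ b)) ≤
        min (max c (ρ a) - min c (ρ a)) (min c (ρ a) + k + 1 - max c (ρ a)) + p.length := by
      intro a b p c hc
      induction p with
      | nil => simp
      | @cons a b d hab p ih =>
        rw [Walk.length_cons]
        have h1 := hstep' a b hab
        have h2 := hρk a
        have h3 := hρk b
        refine ih.trans ?_
        omega
    obtain ⟨p, hp⟩ := hG.connected.exists_walk_length_eq_dist (w i) (w j)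
    have := hwalk _ _ p i (by omega)
    rw [hρw i (by omega), hρw j hj, hp] at this
    omega

end IsFace
end SimpleGraph

/-! ### The position of a vertex relative to a face -/

namespace SimpleGraph

variable {V : Type*} {G : SimpleGraph V} [LinearOrder V]

/-- The position of a vertex `x` relative to a face `w 0 < ⋯ < w k`: it lies in the part
`w i ≤ x < w (i + 1)`, and has distance `α` from `w i` and `β` from `w (i + 1)`.  The last vertex
`w k` has the position `(k, 0, 1)`, as if `w 0` were its successor on the cycle.  The fields
`dist_le` and `dist_gt` give the distances from the vertices of the face. -/
structure IsPos (G : SimpleGraph V) (k : ℕ) (w : ℕ → V) (x : V) (i α β : ℕ) : Prop where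
  le : i ≤ k
  mem_le : w i ≤ x
  mem_lt : i < k → x < w (i + 1)
  one_le : 1 ≤ β
  beta_le : β ≤ α + 1
  alpha_le : α ≤ β + 1
  eq_of_zero : α = 0 → x = w i ∧ β = 1
  zero_of_eq : x = w i → α = 0
  zero_of_last : i = k → α = 0
  zero_of_covBy : i < k → w i ⋖ w (i + 1) → α = 0
  dist_left : G.dist (w i) x = α
  dist_right : i < k → G.dist (w (i + 1)) x = β
  dist_le : ∀ j ≤ i, G.dist (w j) x = min (i - j + α) (k + j - i + β)
  dist_gt : ∀ j ≤ k, i < j → G.dist (w j) x = min (i + k + 1 - j + α) (j - i - 1 + β)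

namespace IsFace

variable {u v : V} {k : ℕ} {w : ℕ → V}

theorem isPos_vertex (h : G.IsFace u v k w) (hG : G.IsOuterOrder) {i : ℕ} (hi : i ≤ k) :
    G.IsPos k w (w i) i 0 1 where
  le := hi
  mem_le := le_rfl
  mem_lt hi := h.lt_succ i hi
  one_le := le_rfl
  beta_le := le_rfl
  alpha_le := by omega
  eq_of_zero _ := ⟨rfl, rfl⟩
  zero_of_eq _ := rfl
  zero_of_last _ := rfl
  zero_of_covBy _ _ := rfl
  dist_left := dist_self
  dist_right hi := dist_eq_one_iff_adj.mpr (h.adj i hi).symm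
  dist_le j hj := by
    rw [h.dist_apply hG hj hi]
    omega
  dist_gt j hj hij := by
    rw [dist_comm, h.dist_apply hG hij.le hj]
    omega

theorem isPos_of_lt (h : G.IsFace u v k w) (hG : G.IsOuterOrder) {i : ℕ} {x : V} (hi : i < k)
    (h1 : w i < x) (h2 : x < w (i + 1)) :
    G.IsPos k w x i (G.dist (w i) x) (G.dist (w (i + 1)) x) := by
  have hα : 0 < G.dist (w i) x := hG.connected.pos_dist_of_ne h1.ne
  have hβ : 0 < G.dist (w (i + 1)) x := hG.connected.pos_dist_of_ne h2.ne'
  have hαβ := hG.connected.dist_le_succ (h.adj i hi) x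
  have hβα := hG.connected.dist_le_succ (h.adj i hi).symm x
  rw [dist_comm, G.dist_comm (u := x)] at hαβ hβα
  have hd : ∀ j ≤ k, G.dist (w j) x =
      min (G.dist (w j) (w i) + G.dist (w i) x) (G.dist (w j) (w (i + 1)) + G.dist (w (i + 1)) x) :=
    fun j hj => hG.dist_eq_min (h.adj i hi) ⟨h1.le, h2.le⟩ (h.notMem_Ioo hi hj)
  refine ⟨hi.le, h1.le, fun _ => h2, hβ, hαβ, hβα, fun h => by omega, fun h => absurd h h1.ne',
    fun h => by omega, fun _ h => absurd h2 (h.2 h1), rfl, fun _ => rfl, fun j hj => ?_,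
    fun j hj hij => ?_⟩
  · rw [hd j (by omega), h.dist_apply hG hj hi.le, h.dist_apply hG (by omega) hi]
    omega
  · rw [hd j hj, G.dist_comm (u := w j), G.dist_comm (u := w j), h.dist_apply hG hij.le hj,
      h.dist_apply hG hij hj]
    omega

theorem exists_isPos (h : G.IsFace u v k w) (hG : G.IsOuterOrder) {x : V}
    (hx : x ∈ Set.Icc u v) : ∃ i α β, G.IsPos k w x i α β := by
  rcases hx.2.eq_or_lt with rfl | hxv
  · exact ⟨k, 0, 1, h.last ▸ h.isPos_vertex hG le_rfl⟩
  · obtain ⟨i, hi, h1, h2⟩ := exists_le_lt_succ (w := w) (k := k) (x := x)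
      (by rw [h.zero]; exact hx.1) (by rw [h.last]; exact hxv)
    rcases h1.eq_or_lt with rfl | h1
    · exact ⟨i, 0, 1, h.isPos_vertex hG hi.le⟩
    · exact ⟨i, _, _, h.isPos_of_lt hG hi h1 h2⟩

/-- The neighbours of a vertex in `[w i, w (i + 1))` stay below `w (i + 1)`, apart from the edge
between the ends of the face. -/
theorem adj_le (h : G.IsFace u v k w) (hG : G.IsOuterOrder) {i α β : ℕ} {x y : V}
    (hx : G.IsPos k w x i α β) (hi : i < k) (hxu : x ≠ u) (hxy : x = y ∨ G.Adj x y) :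
    y ≤ w (i + 1) := by
  have hux : u < x := lt_of_le_of_ne (h.zero ▸ (h.le_of_le (Nat.zero_le i) hi.le).trans hx.mem_le)
    hxu.symm
  have hxv : x < v := (hx.mem_lt hi).trans_le (h.mem_Icc hi).2
  by_contra! hlt
  rcases hxy with rfl | hxy
  · exact absurd (hx.mem_lt hi) (not_lt.mpr hlt.le)
  have hlt' : x < y := (hx.mem_lt hi).trans hlt
  have hyv : y ≤ v := by
    by_contra hyv
    exact hG.nonCrossing hux hxv (not_le.mp hyv) h.adj_ends hxy
  rcases h.edge x y hux.le hlt' hyv hxy with ⟨h1, -⟩ | ⟨m, hm, h1, h2⟩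
  · exact hxu h1
  · have := h.lt_of_apply_lt hm.le (h1.trans_lt (hx.mem_lt hi))
    exact absurd (h2.trans (h.le_of_le (by omega) hi)) (not_le.mpr hlt)

/-- The neighbours of a vertex of the part of `w i` stay above `w i` or, if the vertex is `w i`
itself, above `w (i - 1)`. -/
theorem le_adj (h : G.IsFace u v k w) (hG : G.IsOuterOrder) {i α β j : ℕ} {x y : V}
    (hx : G.IsPos k w x i α β) (hi : i < k) (hxu : x ≠ u) (hj : j ≤ i) (hj' : α = 0 → j + 1 ≤ i)
    (hxy : x = y ∨ G.Adj x y) : w j ≤ y := by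
  have hux : u < x := lt_of_le_of_ne (h.zero ▸ (h.le_of_le (Nat.zero_le i) hi.le).trans hx.mem_le)
    hxu.symm
  have hxv : x < v := (hx.mem_lt hi).trans_le (h.mem_Icc hi).2
  have hjx : w j ≤ x := (h.le_of_le hj hi.le).trans hx.mem_le
  rcases hxy with rfl | hxy
  · exact hjx
  by_contra! hlt
  have hlt' : y < x := hlt.trans_le hjx
  have hyu : u ≤ y := by
    by_contra hyu
    exact hG.nonCrossing (not_le.mp hyu) hux hxv hxy.symm h.adj_ends
  rcases h.edge y x hyu hlt' hxv.le hxy.symm with ⟨-, h1⟩ | ⟨m, hm, h1, h2⟩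
  · exact hxv.ne h1
  · have hmj := h.lt_of_apply_lt hm.le (h1.trans_lt hlt)
    rcases hx.mem_le.eq_or_lt with heq | hlt2
    · have h0 := hj' (hx.zero_of_eq heq.symm)
      rw [← heq] at h2
      have := h.le_of_le (i := m + 1) (j := i) (by omega) hi.le
      have h3 : w (m + 1) ≤ w j := h.le_of_le (by omega) (by omega)
      have h4 : w j < w i := h.lt_of_lt (by omega) hi.le
      exact absurd (h2.trans h3) (not_le.mpr h4)
    · have := h.lt_of_apply_lt hi.le (hlt2.trans_le h2)
      omega

end IsFace
end SimpleGraph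

/-! ### Two consecutive edges of a face, with one outer end possible -/

namespace SimpleGraph

variable {V : Type*} {G : SimpleGraph V} [LinearOrder V]

theorem IsPos.dist_first {k i α β : ℕ} {w : ℕ → V} {x : V} (h : G.IsPos k w x i α β) :
    G.dist (w 0) x = min (i + α) (k - i + β) := by
  have := h.dist_le 0 (Nat.zero_le _)
  simpa using this

/-- The summands `1` avoid a truncated subtraction for `i = k`. -/
theorem IsPos.dist_last {k i α β : ℕ} {w : ℕ → V} {x : V} (h : G.IsPos k w x i α β) :
    G.dist (w k) x + 1 = min (i + 1 + α + 1) (k - i + β) := by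
  have h1 := h.le
  have h2 := h.one_le
  rcases h1.eq_or_lt with rfl | h1
  · have h3 := h.dist_le i le_rfl
    have h4 := h.zero_of_last rfl
    have h5 := h.eq_of_zero h4
    omega
  · have h3 := h.dist_gt k le_rfl h1
    omega

/-! The next three lemmas contain the arithmetic of probes at the vertex `w s` opposite to `w 0`
on a face with `k + 1` vertices.  Here `(i, α, β)` is the position of a vertex `b` below the face,
and `Y`, `W`, `Z` and `Q` are its distances from `y`, `w 0`, `w k` and `w s`, where `y` is a
neighbour of `w 0` at distance `D` from `w k`.  A vertex `a` below the edge between `y` and `w 0`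
has the distances `x` and `t` from the ends of this edge, and gives the same answers as `b`.  The
conclusion is that `b` is below the edge between `w 0` and `w 1`, or located. -/

theorem arith_Ico {k s i α β x t W Z Y D Q : ℕ} (hs : s = (k + 1) / 2) (hk : 2 ≤ k) (hi : i < k)
    (hβ : β ≤ α + 1) (hα : α ≤ β + 1)
    (hW : W = min (i + α) (k - i + β)) (hZ : Z + 1 = min (i + 1 + α + 1) (k - i + β))
    (hY : Y = min (1 + W) (D + Z)) (hD : 2 ≤ D) (hxY : x = Y) (hxt : x ≤ t + 1)
    (hQ : s + t ≤ Q)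
    (h1 : s ≤ i → Q = min (i - s + α) (k + s - i + β))
    (h2 : i < s → Q = min (i + k + 1 - s + α) (s - i - 1 + β)) :
    i = 0 ∧ β = α + 1 ∧ t = α ∧ x = α + 1 := by
  have hY' : Y = 1 + W := by clear h1 h2; omega
  clear hY hZ
  rcases Nat.lt_or_ge i s with h | h
  · have h3 := h2 h
    have hW' : W = i + α := by clear h1 h2 h3; omega
    have h4 : Q ≤ s - i - 1 + β := by rw [h3]; exact min_le_right _ _
    clear h1 h2 h3 hW
    omega
  · have h3 : Q ≤ i - s + α := by rw [h1 h]; exact min_le_left _ _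
    exfalso
    clear h1 h2
    rcases min_choice (i + α) (k - i + β) with h4 | h4 <;> rw [h4] at hW <;> omega

theorem arith_Ioo {k s i α β x t W D Q : ℕ} (hs : s = (k + 1) / 2) (hk : 2 ≤ k) (hi : i < k)
    (hβ : β ≤ α + 1) (hα : α ≤ β + 1) (hβ1 : 1 ≤ β)
    (hW : W = min (i + α) (k - i + β)) (hx : 1 ≤ x) (htx : t ≤ x + 1) (hxt : x ≤ t + 1)
    (ht : 1 ≤ t) (hD : 1 ≤ D) (htW : t = W)
    (hQ : Q = min (s + t) (k - s + min (D + x) (1 + t)))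
    (h1 : s ≤ i → Q = min (i - s + α) (k + s - i + β))
    (h2 : i < s → Q = min (i + k + 1 - s + α) (s - i - 1 + β)) :
    i = 0 ∧ 2 ≤ β := by
  have hQ1 : s + t ≤ Q + 1 := by clear h1 h2; omega
  have hQ2 : t = 1 → s + t ≤ Q := by clear h1 h2; omega
  have hQ3 : k = 2 * s → s + t ≤ Q := by clear h1 h2; omega
  clear hQ
  rcases Nat.lt_or_ge i s with h | h
  · have h3 := h2 h
    have hW' : W = i + α := by clear h1 h2 h3; omega
    have h4 : Q ≤ s - i - 1 + β := by rw [h3]; exact min_le_right _ _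
    clear h1 h2 h3 hW
    omega
  · have h3 : Q ≤ i - s + α := by rw [h1 h]; exact min_le_left _ _
    exfalso
    clear h1 h2
    rcases min_choice (i + α) (k - i + β) with h4 | h4 <;> rw [h4] at hW <;> omega

theorem arith_Icc {k s i α β x t W Z D Q : ℕ} (hs : s = (k + 1) / 2) (hk : 2 ≤ k) (hi : i ≤ k)
    (hβ : β ≤ α + 1) (hα : α ≤ β + 1) (hβ1 : 1 ≤ β) (hik : i = k → α = 0)
    (hW : W = min (i + α) (k - i + β)) (hZ : Z + 1 = min (i + 1 + α + 1) (k - i + β))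
    (hxt : x ≤ t + 1) (htx : t ≤ x + 1)
    (hx0 : x = 0 → t = 1)
    (hW1 : W ≤ 1) (hZx : Z = x) (hD : 2 ≤ D)
    (hQ : Q = min (s + t) (min (s + 1) (k - s + D) + x))
    (h1 : s ≤ i → Q = min (i - s + α) (k + s - i + β))
    (h2 : i < s → Q = min (i + k + 1 - s + α) (s - i - 1 + β)) :
    (t = 0 ∧ W = 0) ∨ (i = 0 ∧ α = 1 ∧ β = 2 ∧ t = 1 ∧ x = 2) := by
  have hQ' : Q = s + t := by clear h1 h2; omega
  clear hQ
  rcases Nat.lt_or_ge i s with h | h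
  · have h3 := h2 h
    have hW' : W = i + α := by clear h1 h2 h3; omega
    have h4 : Q ≤ s - i - 1 + β := by rw [h3]; exact min_le_right _ _
    clear h1 h2 h3 hW
    omega
  · have h3 : Q ≤ i - s + α := by rw [h1 h]; exact min_le_left _ _
    clear h1 h2
    rcases min_choice (i + α) (k - i + β) with h4 | h4 <;> rw [h4] at hW <;> omega

variable [Fintype V]

theorem chordFinset_mono {u v u' v' : V} (hu : u ≤ u') (hv : v' ≤ v) :
    G.chordFinset u' v' ⊆ G.chordFinset u v := by
  intro p hp
  rw [mem_chordFinset] at hp ⊢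
  exact ⟨hu.trans hp.1, hp.2.1, hp.2.2.1.trans hv, hp.2.2.2⟩

theorem card_chordFinset_pos {u v : V} (huv : u < v) (ha : G.Adj u v) (hn : ¬ u ⋖ v) :
    1 ≤ (G.chordFinset u v).card :=
  Finset.card_pos.mpr ⟨(u, v), mem_chordFinset.mpr ⟨le_rfl, huv, le_rfl, ha, hn⟩⟩

namespace IsFace

variable {u v : V} {k : ℕ} {w : ℕ → V}

omit [Fintype V] in
theorem not_covBy (h : G.IsFace u v k w) : ¬ u ⋖ v := by
  intro hc
  have h1 := h.two_le
  have h2 := h.lt_of_lt (i := 0) (j := 1) (by omega) (by omega)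
  have h3 := h.lt_of_lt (i := 1) (j := k) (by omega) le_rfl
  rw [h.zero] at h2
  rw [h.last] at h3
  exact hc.2 h2 h3

/-- The chords below the different edges of a face are different from each other and from the edge
above the face. -/
theorem sum_card_chordFinset_lt (h : G.IsFace u v k w) (I : Finset ℕ) (hI : ∀ i ∈ I, i < k) :
    ∑ i ∈ I, (G.chordFinset (w i) (w (i + 1))).card < (G.chordFinset u v).card := by
  classical
  have hd : (I : Set ℕ).PairwiseDisjoint fun i => G.chordFinset (w i) (w (i + 1)) := by
    have key : ∀ i j, i < j → j < k →
        Disjoint (G.chordFinset (w i) (w (i + 1))) (G.chordFinset (w j) (w (j + 1))) := by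
      intro i j hij hj
      rw [Finset.disjoint_left]
      intro p h1 h2
      rw [mem_chordFinset] at h1 h2
      exact absurd (h1.2.1.trans_le h1.2.2.1)
        (not_lt.mpr ((h.le_of_le (i := i + 1) hij hj.le).trans h2.1))
    intro i hi j hj hij
    rcases lt_or_gt_of_ne hij with hlt | hlt
    · exact key i j hlt (hI j hj)
    · exact (key j i hlt (hI i hi)).symm
  rw [← Finset.card_biUnion hd]
  refine Finset.card_lt_card (Finset.ssubset_iff_of_subset ?_ |>.mpr ⟨(u, v), ?_, ?_⟩)
  · intro p hp
    obtain ⟨i, hi, hp⟩ := Finset.mem_biUnion.mp hp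
    exact chordFinset_mono (h.mem_Icc (hI i hi).le).1 (h.mem_Icc (i := i + 1) (hI i hi)).2 hp
  · exact mem_chordFinset.mpr ⟨le_rfl, h.ends_lt, le_rfl, h.adj_ends, h.not_covBy⟩
  · intro hp
    obtain ⟨i, hi, hp⟩ := Finset.mem_biUnion.mp hp
    have hik := hI i hi
    have h2 := h.two_le
    rw [mem_chordFinset, ← h.zero, ← h.last] at hp
    by_cases h0 : i = 0
    · exact absurd hp.2.2.1 (not_le.mpr (h.lt_of_lt (by omega) le_rfl))
    · exact absurd hp.1 (not_le.mpr (h.lt_of_lt (by omega) (by omega)))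

theorem card_chordFinset_lt (h : G.IsFace u v k w) {i : ℕ} (hi : i < k) :
    (G.chordFinset (w i) (w (i + 1))).card < (G.chordFinset u v).card := by
  simpa using h.sum_card_chordFinset_lt {i} (by simpa)

end IsFace

/-- The cops win from the whole interval `[a, b]` below a chord `ab` with as many probes as there
are chords below it, provided that this number is less than `N`. -/
def WinsBelow (G : SimpleGraph V) (N : ℕ) : Prop :=
  ∀ a b : V, a < b → G.Adj a b → ¬ a ⋖ b → (G.chordFinset a b).card < N →
    G.Wins (G.chordFinset a b).card (Set.Icc a b)

theorem WinsBelow.wins [Nonempty V] {N M : ℕ} (ih : G.WinsBelow N) {a b : V} (hab : a < b)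
    (ha : G.Adj a b) (hn : ¬ a ⋖ b) (hN : (G.chordFinset a b).card < N)
    (hM : (G.chordFinset a b).card ≤ M) {S : Set V} (hS : S ⊆ Set.Icc a b) : G.Wins M S :=
  ((ih a b hab ha hn hN).le hM).mono hS

omit [Fintype V] in
theorem reach_subset_Ico {y w z' : V} (hG : G.IsOuterOrder) (hyw : G.Adj y w) (hwz : G.Adj w z')
    (h1 : y < w) (h2 : w < z') {C : Set V}
    (hC : ∀ c ∈ C, c ∈ Set.Ioo y w ∨ c ∈ Set.Ioo w z' ∧ 2 ≤ G.dist z' c) :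
    G.reach C ⊆ Set.Ico y z' := by
  rintro x ⟨c, hc, hx⟩
  rcases hC c hc with h | ⟨h, hd⟩
  · have := hG.nonCrossing.reach_Ioo hyw (Set.singleton_subset_iff.mpr h) ⟨c, rfl, hx⟩
    exact ⟨this.1, this.2.trans_lt h2⟩
  · have hx' := hG.nonCrossing.reach_Ioo hwz (Set.singleton_subset_iff.mpr h) ⟨c, rfl, hx⟩
    refine ⟨h1.le.trans hx'.1, lt_of_le_of_ne hx'.2 ?_⟩
    rintro rfl
    rcases hx with rfl | hx
    · simp at hd
    · rw [dist_eq_one_iff_adj.mpr hx.symm] at hd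
      omega

/-- The vertex `q s` opposite to `w` on the face below the edge `wz`, and its distances from the
ends of the edges `yw` and `wz`. -/
theorem IsOuterOrder.exists_opposite (hG : G.IsOuterOrder) {y w z : V} (hyw : y < w)
    (hayw : G.Adj y w) (hwz : w < z) (hawz : G.Adj w z) (hn : ¬ w ⋖ z) :
    ∃ k q s, G.IsFace w z k q ∧ s = (k + 1) / 2 ∧ q s ∈ Set.Icc w z ∧ q s ∉ Set.Ioo y w ∧
      G.dist (q s) w = s ∧ G.dist z (q s) = k - s ∧
      G.dist (q s) y = min (s + 1) (k - s + G.dist y z) ∧ w < q 1 ∧ q 1 < z ∧ G.Adj w (q 1) ∧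
      (G.chordFinset w (q 1)).card < (G.chordFinset w z).card := by
  obtain ⟨k, q, hq⟩ := hG.exists_isFace hwz hawz hn
  have hk := hq.two_le
  have hw1 := hq.lt_succ 0 (by omega)
  have hwz1 := hq.lt_of_lt (i := 1) (j := k) (by omega) le_rfl
  have haw1 := hq.adj 0 (by omega)
  have hlt1 := hq.card_chordFinset_lt (i := 0) (by omega)
  simp only [zero_add, hq.zero, hq.last] at hw1 hwz1 haw1 hlt1
  obtain ⟨s, hs⟩ : ∃ s, s = (k + 1) / 2 := ⟨_, rfl⟩
  have hsm := hq.mem_Icc (i := s) (by omega)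
  have hpw : G.dist (q s) w = s := by
    have := hq.dist_apply hG (i := 0) (j := s) (by omega) (by omega)
    rw [hq.zero, dist_comm] at this
    omega
  have hpz : G.dist z (q s) = k - s := by
    have := hq.dist_apply hG (i := s) (j := k) (by omega) (by omega)
    rw [hq.last, dist_comm] at this
    omega
  refine ⟨k, q, s, hq, hs, hsm, fun h => absurd h.2 (not_lt.mpr hsm.1), hpw, hpz, ?_, hw1, hwz1,
    haw1, hlt1⟩
  have h1 := hG.dist_eq_min (q := y) hawz hsm fun h => absurd h.1 (not_lt.mpr hyw.le)
  rw [G.dist_comm (u := w), hpw, hpz, dist_eq_one_iff_adj.mpr hayw, dist_comm] at h1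
  omega

/-- The cops know the robber to be below one of two consecutive edges `yw` and `wz`; he may be at
`y`, but not at `z`. They probe `y` and a vertex `p` opposite to `w` on the face below `wz`.  If
the answer does not tell on which side of `w` the robber is, then he is either below `yw`, or
below the edge of the face that leaves `w`, where he is closer to `w` than to its other end. -/
theorem WinsBelow.wins_Ico [Nonempty V] (hG : G.IsOuterOrder) {N : ℕ} (ih : G.WinsBelow N)
    {y w : V} (hyw : y < w) (hayw : G.Adj y w) (hn : ¬ y ⋖ w)
    (hNy : (G.chordFinset y w).card < N) (n : ℕ) :
    ∀ (z : V) (M : ℕ) (S : Set V), w < z → G.Adj w z → (G.chordFinset w z).card < N →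
      (G.chordFinset w z).card ≤ n → 2 ≤ G.dist y z → S ⊆ Set.Ico y z →
      (G.chordFinset y w).card + (G.chordFinset w z).card ≤ M → G.Wins M S := by
  have hposy := card_chordFinset_pos hyw hayw hn
  induction n with
  | zero =>
    intro z M S hwz hawz hNz hle hd hS hM
    have hc : w ⋖ z := by
      by_contra hc
      have := card_chordFinset_pos hwz hawz hc
      omega
    exact ih.wins hyw hayw hn hNy (by omega) fun x hx => ⟨(hS hx).1, hc.le_of_lt (hS hx).2⟩
  | succ n ihn =>
    intro z M S hwz hawz hNz hle hd hS hM
    by_cases hc : w ⋖ z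
    · exact ih.wins hyw hayw hn hNy (by omega) fun x hx => ⟨(hS hx).1, hc.le_of_lt (hS hx).2⟩
    obtain ⟨k, q, s, hq, hs, hsm, hps, hpw, hpz, hpy, hw1, hwz1, haw1, hlt1⟩ :=
      hG.exists_opposite hyw hayw hwz hawz hc
    have hposz := card_chordFinset_pos hwz hawz hc
    have hk := hq.two_le
    have hys : y ∉ Set.Ioo w z := fun h => absurd h.1 (not_lt.mpr hyw.le)
    have hyw1 : G.dist y w = 1 := dist_eq_one_iff_adj.mpr hayw
    have hpy' : G.dist (q s) y = s + 1 := by omega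
    have claim : ∀ a ∈ Set.Ioc y w, ∀ b ∈ Set.Ico w z, G.dist y a = G.dist y b →
        G.dist (q s) a = G.dist (q s) b → G.dist y a = G.dist w a + 1 ∧
        G.dist w b = G.dist w a ∧
        (b = w ∨ b ∈ Set.Ioo w (q 1) ∧ G.dist (q 1) b = G.dist w a + 1) := by
      intro a ha b hb h1 h2
      obtain ⟨i, α, β, hp⟩ := hq.exists_isPos hG (Set.Ico_subset_Icc_self hb)
      have e1 := hG.dist_eq_min (q := q s) hayw (Set.Ioc_subset_Icc_self ha) hps
      have e2 := hG.dist_eq_min (q := y) hawz (Set.Ico_subset_Icc_self hb) hys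
      have e3 := hp.dist_first
      have e4 := hp.dist_last
      have e5 := hG.connected.dist_le_succ hayw a
      have e5' := hG.connected.dist_le_succ hayw.symm a
      rw [G.dist_comm (v := w), G.dist_comm (v := y)] at e5 e5'
      rw [hq.zero] at e3
      rw [hq.last] at e4
      have e6 := hp.dist_le s
      have e7 := hp.dist_gt s (by omega)
      have hi : i < k := by
        by_contra hi
        have h3 := hp.le
        have h4 := hp.mem_le
        rw [show i = k by omega, hq.last] at h4
        exact absurd hb.2 (not_lt.mpr h4)
      have e8 := hp.beta_le
      have e9 := hp.alpha_le
      have hi0 : i = 0 ∧ β = α + 1 ∧ G.dist w a = α ∧ G.dist y a = α + 1 := by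
        refine arith_Ico hs hk hi e8 e9 e3 e4 (hyw1 ▸ e2) hd h1 e5' ?_ (fun h => h2 ▸ e6 h)
          (fun h => h2 ▸ e7 h)
        omega
      obtain ⟨rfl, rfl, h5, h6⟩ := hi0
      refine ⟨by omega, by omega, ?_⟩
      rcases hb.1.eq_or_lt with h7 | h7
      · exact Or.inl h7.symm
      · exact Or.inr ⟨⟨h7, hp.mem_lt hi⟩, by rw [h5]; exact hp.dist_right hi⟩
    refine Wins.of_probe (by omega) y (q s) fun x hx => ?_
    set C := G.probeClass S y (q s) x with hCdef
    by_cases hxy : x = y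
    · left
      rintro c ⟨-, hc, -⟩
      rw [hxy, dist_self] at hc
      rw [hxy]
      exact (hG.connected.dist_eq_zero_iff.mp hc).symm
    have hCy : ∀ c ∈ C, c ≠ y := by
      rintro c ⟨-, hc, -⟩ rfl
      rw [dist_self] at hc
      exact hxy (hG.connected.dist_eq_zero_iff.mp hc.symm).symm
    have hxC : x ∈ C := mem_probeClass_self hx
    by_cases hR : C ⊆ Set.Ioo w z
    · exact Or.inr (ih.wins hwz hawz hc hNz (by omega) (hG.nonCrossing.reach_Ioo hawz hR))
    by_cases hL : C ⊆ Set.Ioo y w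
    · exact Or.inr (ih.wins hyw hayw hn hNy (by omega) (hG.nonCrossing.reach_Ioo hayw hL))
    obtain ⟨a, haC, ha⟩ := Set.not_subset.mp hR
    obtain ⟨b, hbC, hb⟩ := Set.not_subset.mp hL
    have hIoc : ∀ c ∈ C, c ∉ Set.Ioo w z → c ∈ Set.Ioc y w := fun c hc h =>
      ⟨lt_of_le_of_ne (hS hc.1).1 (hCy c hc).symm, not_lt.mp fun h' => h ⟨h', (hS hc.1).2⟩⟩
    have hIco : ∀ c ∈ C, c ∉ Set.Ioo y w → c ∈ Set.Ico w z := fun c hc h =>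
      ⟨not_lt.mp fun h' => h ⟨lt_of_le_of_ne (hS hc.1).1 (hCy c hc).symm, h'⟩, (hS hc.1).2⟩
    have hdist : ∀ c ∈ C, ∀ d ∈ C, G.dist y c = G.dist y d ∧ G.dist (q s) c = G.dist (q s) d :=
      fun c hc d hd => ⟨hc.2.1.trans hd.2.1.symm, hc.2.2.trans hd.2.2.symm⟩
    have hab := claim a (hIoc a haC ha) b (hIco b hbC hb) (hdist a haC b hbC).1
      (hdist a haC b hbC).2
    -- every vertex of the class is like `a` or like `b`
    have hall : ∀ c ∈ C, (c ∈ Set.Ioc y w ∧ G.dist w c = G.dist w a) ∨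
        (c ∈ Set.Ioo w (q 1) ∧ G.dist (q 1) c = G.dist w a + 1 ∧ G.dist w c = G.dist w a) := by
      intro c hc
      by_cases hcw : c ∈ Set.Ioo w z
      · right
        have h1 := claim a (hIoc a haC ha) c (Set.Ioo_subset_Ico_self hcw) (hdist a haC c hc).1
          (hdist a haC c hc).2
        rcases h1.2.2 with h2 | h2
        · exact absurd hcw.1 (by rw [h2]; exact lt_irrefl _)
        · exact ⟨h2.1, h2.2, h1.2.1⟩
      · left
        have h1 := claim c (hIoc c hc hcw) b (hIco b hbC hb) (hdist c hc b hbC).1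
          (hdist c hc b hbC).2
        exact ⟨hIoc c hc hcw, by omega⟩
    by_cases ht : G.dist w a = 0
    · left
      have hw : ∀ c ∈ C, c = w := by
        intro c hc
        have : G.dist w c = 0 := by
          rcases hall c hc with h | h <;> omega
        exact (hG.connected.dist_eq_zero_iff.mp this).symm
      intro c hc
      rw [Set.mem_singleton_iff, hw c hc, hw x hxC]
    · right
      refine ihn (q 1) (M - 1) _ hw1 haw1 (by omega) (by omega) ?_
        (reach_subset_Ico hG hayw haw1 hyw hw1 fun c hc => ?_) (by omega)
      · have h1 : G.dist y (q 1) ≠ 0 := fun h =>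
          absurd (hG.connected.dist_eq_zero_iff.mp h) (hyw.trans hw1).ne
        have h2 : G.dist y (q 1) ≠ 1 := fun h => hG.nonCrossing.not_adj_of_mem_Ioo hawz
          (fun h' => absurd h'.1 (not_le.mpr hyw)) ⟨hw1, hwz1⟩ (dist_eq_one_iff_adj.mp h)
        omega
      · rcases hall c hc with ⟨h, h'⟩ | ⟨h, h', -⟩
        · left
          refine ⟨h.1, lt_of_le_of_ne h.2 ?_⟩
          rintro rfl
          rw [dist_self] at h'
          exact ht h'.symm
        · exact Or.inr ⟨h, by omega⟩

end SimpleGraph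

/-! ### Two consecutive edges of a face, with none or both of the outer ends possible -/

namespace SimpleGraph

variable {V : Type*} {G : SimpleGraph V} [LinearOrder V] [Fintype V]

/-- The cops know the robber to be below one of two consecutive edges `yw` and `wz`, but neither at
`y` nor at `z`. They probe `w` and a vertex opposite to `w` on the face below `wz`. -/
theorem WinsBelow.wins_Ioo [Nonempty V] (hG : G.IsOuterOrder) {N : ℕ} (ih : G.WinsBelow N)
    {y w z : V} (hyw : y < w) (hayw : G.Adj y w) (hwz : w < z) (hawz : G.Adj w z)
    (hNy : (G.chordFinset y w).card < N) (hNz : (G.chordFinset w z).card < N) {M : ℕ} (hM1 : 1 ≤ M)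
    (hM : (G.chordFinset y w).card + (G.chordFinset w z).card ≤ M) {S : Set V}
    (hS : S ⊆ Set.Ioo y z) : G.Wins M S := by
  by_cases hn : y ⋖ w
  · by_cases hc : w ⋖ z
    · have hw : ∀ x ∈ S, x = w := fun x hx =>
        le_antisymm (hc.le_of_lt (hS hx).2) (hn.ge_of_gt (hS hx).1)
      exact Wins.of_subsingleton hM1 fun a ha b hb => (hw a ha).trans (hw b hb).symm
    · exact ih.wins hwz hawz hc hNz (by omega) fun x hx => ⟨hn.ge_of_gt (hS hx).1, (hS hx).2.le⟩
  by_cases hc : w ⋖ z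
  · exact ih.wins hyw hayw hn hNy (by omega) fun x hx => ⟨(hS hx).1.le, hc.le_of_lt (hS hx).2⟩
  obtain ⟨k, q, s, hq, hs, hsm, hps, hpw, hpz, hpy, hw1, hwz1, haw1, hlt1⟩ :=
    hG.exists_opposite hyw hayw hwz hawz hc
  have hposy := card_chordFinset_pos hyw hayw hn
  have hposz := card_chordFinset_pos hwz hawz hc
  have hk := hq.two_le
  have hyz : 1 ≤ G.dist y z := hG.connected.pos_dist_of_ne (hyw.trans hwz).ne
  have hzw : z ∉ Set.Ioo y w := fun h => absurd h.2 (not_lt.mpr hwz.le)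
  have hzw1 : G.dist z w = 1 := dist_eq_one_iff_adj.mpr hawz.symm
  have claim : ∀ a ∈ Set.Ioo y w, ∀ b ∈ Set.Ioo w z, G.dist w a = G.dist w b →
      G.dist (q s) a = G.dist (q s) b → b ∈ Set.Ioo w (q 1) ∧ 2 ≤ G.dist (q 1) b := by
    intro a ha b hb h1 h2
    obtain ⟨i, α, β, hp⟩ := hq.exists_isPos hG (Set.Ioo_subset_Icc_self hb)
    have e1 := hG.dist_eq_min (q := q s) hayw (Set.Ioo_subset_Icc_self ha) hps
    have e3 := hp.dist_first
    have e5 := hG.connected.dist_le_succ hayw a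
    have e5' := hG.connected.dist_le_succ hayw.symm a
    rw [G.dist_comm (v := w), G.dist_comm (v := y)] at e5 e5'
    rw [hq.zero] at e3
    have hi : i < k := by
      by_contra hi
      have h3 := hp.le
      have h4 := hp.mem_le
      rw [show i = k by omega, hq.last] at h4
      exact absurd hb.2 (not_lt.mpr h4)
    have hx : 1 ≤ G.dist y a := hG.connected.pos_dist_of_ne ha.1.ne
    have ht : 1 ≤ G.dist w a := hG.connected.pos_dist_of_ne ha.2.ne'
    have hi0 : i = 0 ∧ 2 ≤ β := by
      refine arith_Ioo hs hk hi hp.beta_le hp.alpha_le hp.one_le e3 hx e5 e5' ht hyz h1 ?_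
        (fun h => h2 ▸ hp.dist_le s h) (fun h => h2 ▸ hp.dist_gt s (by omega) h)
      omega
    obtain ⟨rfl, h5⟩ := hi0
    exact ⟨⟨hb.1, hp.mem_lt hi⟩, by rw [← hp.dist_right hi] at h5; exact h5⟩
  refine Wins.of_probe hM1 w (q s) fun x hx => ?_
  set C := G.probeClass S w (q s) x with hCdef
  by_cases hxw : x = w
  · left
    rintro c ⟨-, hcd, -⟩
    rw [hxw, dist_self] at hcd
    rw [hxw]
    exact (hG.connected.dist_eq_zero_iff.mp hcd).symm
  have hCw : ∀ c ∈ C, c ≠ w := by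
    rintro c ⟨-, hcd, -⟩ rfl
    rw [dist_self] at hcd
    exact hxw (hG.connected.dist_eq_zero_iff.mp hcd.symm).symm
  right
  by_cases hR : C ⊆ Set.Ioo w z
  · exact ih.wins hwz hawz hc hNz (by omega) (hG.nonCrossing.reach_Ioo hawz hR)
  obtain ⟨a, haC, ha⟩ := Set.not_subset.mp hR
  have hor : ∀ c ∈ C, c ∈ Set.Ioo y w ∨ c ∈ Set.Ioo w z := fun c hc =>
    (lt_or_gt_of_ne (hCw c hc)).imp (fun h => ⟨(hS hc.1).1, h⟩) (fun h => ⟨h, (hS hc.1).2⟩)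
  have ha' := (hor a haC).resolve_right ha
  have hq1z : 2 ≤ G.dist y (q 1) := by
    have h1 : G.dist y (q 1) ≠ 0 := fun h =>
      absurd (hG.connected.dist_eq_zero_iff.mp h) (hyw.trans hw1).ne
    have h2 : G.dist y (q 1) ≠ 1 := fun h => hG.nonCrossing.not_adj_of_mem_Ioo hawz
      (fun h' => absurd h'.1 (not_le.mpr hyw)) ⟨hw1, hwz1⟩ (dist_eq_one_iff_adj.mp h)
    omega
  refine ih.wins_Ico hG hyw hayw hn hNy _ (q 1) (M - 1) _ hw1 haw1 (by omega) le_rfl hq1z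
    (reach_subset_Ico hG hayw haw1 hyw hw1 fun c hcC => (hor c hcC).imp_right fun h => ?_)
    (by omega)
  exact claim a ha' c h (haC.2.1.trans hcC.2.1.symm) (haC.2.2.trans hcC.2.2.symm)

/-- The cops know the robber to be below one of two consecutive edges `yw` and `wz`, but not
strictly below `wz` unless he is at `w` or adjacent to it.  Here he may be at `y` or at `z`. They
probe a vertex `o` that is closer to `y` and to `z` than to `w`, and a vertex opposite to `w` on
the face below `wz`. -/
theorem WinsBelow.wins_Icc [Nonempty V] (hG : G.IsOuterOrder) {N : ℕ} (ih : G.WinsBelow N)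
    {y w z o : V} (hyw : y < w) (hayw : G.Adj y w) (hwz : w < z) (hawz : G.Adj w z)
    (hn : ¬ y ⋖ w) (hc : ¬ w ⋖ z) (hoy : o ∉ Set.Ioo y w) (hoz : o ∉ Set.Ioo w z)
    (hd1 : G.dist o z = G.dist o y) (hd2 : G.dist o w = G.dist o y + 1) (hd : 2 ≤ G.dist y z)
    (hNy : (G.chordFinset y w).card < N) (hNz : (G.chordFinset w z).card < N) {M : ℕ}
    (hM : (G.chordFinset y w).card + (G.chordFinset w z).card ≤ M) {S : Set V}
    (hS : S ⊆ Set.Icc y z) (hS1 : ∀ x ∈ S, w ≤ x → G.dist w x ≤ 1) : G.Wins M S := by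
  obtain ⟨k, q, s, hq, hs, hsm, hps, hpw, hpz, hpy, hw1, hwz1, haw1, hlt1⟩ :=
    hG.exists_opposite hyw hayw hwz hawz hc
  have hposy := card_chordFinset_pos hyw hayw hn
  have hposz := card_chordFinset_pos hwz hawz hc
  have hk := hq.two_le
  have left : ∀ a ∈ Set.Icc y w, G.dist o a = G.dist o y + G.dist y a ∧
      G.dist (q s) a = min (s + G.dist w a) (min (s + 1) (k - s + G.dist y z) + G.dist y a) ∧
      G.dist y a ≤ G.dist w a + 1 ∧ G.dist w a ≤ G.dist y a + 1 := by
    intro a ha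
    have e1 := hG.dist_eq_min (q := q s) hayw ha hps
    have e2 := hG.dist_eq_min (q := o) hayw ha hoy
    have e5 := hG.connected.dist_le_succ hayw a
    have e5' := hG.connected.dist_le_succ hayw.symm a
    rw [G.dist_comm (v := w), G.dist_comm (v := y)] at e5 e5'
    rw [hpy, hpw] at e1
    omega
  have right : ∀ b ∈ Set.Icc w z, G.dist o b = G.dist o y + G.dist z b := by
    intro b hb
    have e2 := hG.dist_eq_min (q := o) hawz hb hoz
    have e5' := hG.connected.dist_le_succ hawz b
    rw [G.dist_comm (v := w), G.dist_comm (v := z)] at e5'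
    omega
  have claim : ∀ a ∈ Set.Icc y w, ∀ b ∈ S, b ∈ Set.Icc w z → G.dist o a = G.dist o b →
      G.dist (q s) a = G.dist (q s) b → (a = w ∧ b = w) ∨
      (a ∈ Set.Ioo y w ∧ b ∈ Set.Ioo w (q 1) ∧ 2 ≤ G.dist (q 1) b) := by
    intro a ha b hbS hb h1 h2
    obtain ⟨i, α, β, hp⟩ := hq.exists_isPos hG hb
    obtain ⟨e1, e2, e3, e4⟩ := left a ha
    have e5 := right b hb
    have e6 := hp.dist_first
    have e7 := hp.dist_last
    rw [hq.zero] at e6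
    rw [hq.last] at e7
    have hx0 : G.dist y a = 0 → G.dist w a = 1 := by
      intro h
      rw [← hG.connected.dist_eq_zero_iff.mp h]
      exact dist_eq_one_iff_adj.mpr hayw.symm
    have key := arith_Icc hs hk hp.le hp.beta_le hp.alpha_le hp.one_le hp.zero_of_last e6 e7 e3 e4
      hx0 (hS1 b hbS hb.1) (by omega) hd e2
      (fun h => h2 ▸ hp.dist_le s h) (fun h => h2 ▸ hp.dist_gt s (by omega) h)
    rcases key with ⟨h3, h4⟩ | ⟨rfl, rfl, rfl, h3, h4⟩
    · exact Or.inl ⟨(hG.connected.dist_eq_zero_iff.mp h3).symm,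
        (hG.connected.dist_eq_zero_iff.mp h4).symm⟩
    · right
      refine ⟨⟨lt_of_le_of_ne ha.1 ?_, lt_of_le_of_ne ha.2 ?_⟩,
        ⟨lt_of_le_of_ne hb.1 ?_, hp.mem_lt (by omega)⟩, (hp.dist_right (by omega)).ge⟩
      · rintro rfl
        rw [dist_self] at h4
        omega
      · rintro rfl
        rw [dist_self] at h3
        omega
      · intro h
        have := hp.zero_of_eq (by rw [hq.zero]; exact h.symm)
        omega
  have hor : ∀ c ∈ S, c ∈ Set.Icc y w ∨ c ∈ Set.Icc w z := fun c hc =>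
    (le_total c w).imp (fun h => ⟨(hS hc).1, h⟩) (fun h => ⟨h, (hS hc).2⟩)
  have hyy : y ∈ Set.Icc y w := ⟨le_rfl, hyw.le⟩
  have hzz : z ∈ Set.Icc w z := ⟨hwz.le, le_rfl⟩
  refine Wins.of_probe (by omega) o (q s) fun x hx => ?_
  set C := G.probeClass S o (q s) x with hCdef
  have hxC : x ∈ C := mem_probeClass_self hx
  have hdist : ∀ c ∈ C, ∀ d ∈ C, G.dist o c = G.dist o d ∧ G.dist (q s) c = G.dist (q s) d :=
    fun c hc d hd => ⟨hc.2.1.trans hd.2.1.symm, hc.2.2.trans hd.2.2.symm⟩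
  -- a vertex of the class that is equal to all others
  have single : ∀ e ∈ C, (∀ c ∈ C, c = e) → C ⊆ {x} := fun e _ h c hc => by
    rw [Set.mem_singleton_iff, h c hc, h x hxC]
  by_cases hyC : y ∈ C
  · left
    refine single y hyC fun c hcC => ?_
    rcases hor c hcC.1 with h | h
    · have h1 := left c h
      have h2 := (hdist c hcC y hyC).1
      exact (hG.connected.dist_eq_zero_iff.mp (by omega)).symm
    · rcases claim y hyy c hcC.1 h (hdist y hyC c hcC).1 (hdist y hyC c hcC).2 with h | h
      · exact absurd h.1 hyw.ne
      · exact absurd h.1.1 (lt_irrefl _)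
  by_cases hzC : z ∈ C
  · left
    refine single z hzC fun c hcC => ?_
    rcases hor c hcC.1 with h | h
    · rcases claim c h z hzC.1 hzz (hdist c hcC z hzC).1 (hdist c hcC z hzC).2 with h | h
      · exact absurd h.2 hwz.ne'
      · exact absurd h.2.1.2 (not_lt.mpr hwz1.le)
    · have h1 := right c h
      have h2 := (hdist c hcC z hzC).1
      exact (hG.connected.dist_eq_zero_iff.mp (by omega)).symm
  have hlow : ∀ c ∈ C, c ∉ Set.Ioo w z → c ∈ Set.Icc y w := fun c hc h =>
    ⟨(hS hc.1).1, not_lt.mp fun h' => h ⟨h', lt_of_le_of_ne (hS hc.1).2 fun e => hzC (e ▸ hc)⟩⟩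
  have hhigh : ∀ c ∈ C, c ∉ Set.Ioo y w → c ∈ Set.Icc w z := fun c hc h =>
    ⟨not_lt.mp fun h' => h ⟨lt_of_le_of_ne (hS hc.1).1 fun e => hyC (e ▸ hc), h'⟩, (hS hc.1).2⟩
  by_cases hR : C ⊆ Set.Ioo w z
  · exact Or.inr (ih.wins hwz hawz hc hNz (by omega) (hG.nonCrossing.reach_Ioo hawz hR))
  by_cases hL : C ⊆ Set.Ioo y w
  · exact Or.inr (ih.wins hyw hayw hn hNy (by omega) (hG.nonCrossing.reach_Ioo hayw hL))
  obtain ⟨a, haC, ha⟩ := Set.not_subset.mp hR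
  obtain ⟨b, hbC, hb⟩ := Set.not_subset.mp hL
  rcases claim a (hlow a haC ha) b hbC.1 (hhigh b hbC hb) (hdist a haC b hbC).1
    (hdist a haC b hbC).2 with ⟨haw, -⟩ | ⟨ha', hb'⟩
  · left
    rw [haw] at haC
    refine single w haC fun c hcC => ?_
    rcases hor c hcC.1 with h | h
    · rcases claim c h w haC.1 ⟨le_rfl, hwz.le⟩ (hdist c hcC w haC).1 (hdist c hcC w haC).2
        with h | h
      · exact h.1
      · exact absurd h.2.1.1 (lt_irrefl _)
    · rcases claim w ⟨hyw.le, le_rfl⟩ c hcC.1 h (hdist w haC c hcC).1 (hdist w haC c hcC).2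
        with h | h
      · exact h.2
      · exact absurd h.1.2 (lt_irrefl _)
  · right
    have hq1z : 2 ≤ G.dist y (q 1) := by
      have h1 : G.dist y (q 1) ≠ 0 := fun h =>
        absurd (hG.connected.dist_eq_zero_iff.mp h) (hyw.trans hw1).ne
      have h2 : G.dist y (q 1) ≠ 1 := fun h => hG.nonCrossing.not_adj_of_mem_Ioo hawz
        (fun h' => absurd h'.1 (not_le.mpr hyw)) ⟨hw1, hwz1⟩ (dist_eq_one_iff_adj.mp h)
      omega
    refine ih.wins_Ico hG hyw hayw hn hNy _ (q 1) (M - 1) _ hw1 haw1 (by omega) le_rfl hq1z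
      (reach_subset_Ico hG hayw haw1 hyw hw1 fun c hcC => ?_) (by omega)
    by_cases hcR : c ∈ Set.Ioo w z
    · rcases claim a (hlow a haC ha) c hcC.1 (Set.Ioo_subset_Icc_self hcR) (hdist a haC c hcC).1
        (hdist a haC c hcC).2 with h | h
      · exact absurd h.2 hcR.1.ne'
      · exact Or.inr h.2
    · rcases claim c (hlow c hcC hcR) b hbC.1 (hhigh b hbC hb) (hdist c hcC b hbC).1
        (hdist c hcC b hbC).2 with h | h
      · exact absurd h.2 hb'.1.1.ne'
      · exact Or.inl h.1

end SimpleGraph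

/-! ### Arithmetic of probes at two adjacent vertices of a face -/

namespace SimpleGraph

/-- The distances `p` and `q` of a vertex in the first half of a face from the ends `w 0` and `w
s` of this half are not realized by paths through the other half. -/
theorem arith_half_low {k s i α β p q : ℕ} (hs : s = (k + 1) / 2) (hi : i ≤ s)
    (hβ : β ≤ α + 1) (hα : α ≤ β + 1) (hβ1 : 1 ≤ β) (hα0 : i = s → α = 0)
    (hp : p = min (i + α) (k - i + β)) (hq : i < s → q = min (i + k + 1 - s + α) (s - i - 1 + β))
    (hq' : s ≤ i → q = min (i - s + α) (k + s - i + β)) :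
    p = i + α ∧ q + i + 1 = s + β := by
  rcases hi.eq_or_lt with rfl | hi
  · have := hq' le_rfl
    omega
  · have := hq hi
    omega

/-- The analogue of `arith_half_low` for the second half, with the ends `w h` and `w k`. -/
theorem arith_half_high {k h i α β p q : ℕ} (hs : h = k / 2) (hi : h ≤ i) (hik : i ≤ k)
    (hβ : β ≤ α + 1) (hα : α ≤ β + 1) (hβ1 : 1 ≤ β) (hα0 : i = k → α = 0)
    (hp : p = min (i - h + α) (k + h - i + β)) (hq : q + 1 = min (i + 1 + α + 1) (k - i + β)) :
    p + h = i + α ∧ q + i + 1 = k + β := by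
  rcases hik.eq_or_lt with rfl | hik
  · omega
  · omega

/-- The possible distances `p` and `q` of a vertex from two consecutive vertices `w s` and `w (s +
1)`, where `s = ⌈k / 2⌉`, of a face with `k + 1` vertices, when only the two edges at `w 0` have
vertices below them.  The vertex has the position `(ρ, α, β)`; thus `α = 0` for the vertices of
the face, and otherwise `ρ` is `0` or `k`. -/
def OppositeDist (k s ρ α β p q : ℕ) : Prop :=
    (α = 0 ∧ s + 1 ≤ ρ ∧ p + s = ρ ∧ q + 1 = p) ∨ (α = 0 ∧ 1 ≤ ρ ∧ ρ + p = s ∧ q = p + 1) ∨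
    (ρ = 0 ∧ k = 2 * s ∧ p + 1 = s + β ∧ q = s + min α β) ∨
    (ρ = 0 ∧ k + 1 = 2 * s ∧ p + 1 = s + β ∧ q + 1 = s + α) ∨
    (ρ = k ∧ 1 ≤ α ∧ k = 2 * s ∧ p = s + min α β ∧ q + 1 = s + α) ∨
    (ρ = k ∧ 1 ≤ α ∧ k + 1 = 2 * s ∧ p + 1 = s + α ∧ q + 2 = s + α)

theorem arith_opposite_dist {k s ρ α β p q : ℕ} (hk : 2 ≤ k) (hs : s = (k + 1) / 2)
    (hρ : ρ ≤ k) (hβ : β ≤ α + 1) (hα : α ≤ β + 1) (hβ1 : 1 ≤ β)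
    (h0 : α = 0 → β = 1) (hz : α ≠ 0 → ρ = 0 ∨ ρ = k)
    (hp1 : s ≤ ρ → p = min (ρ - s + α) (k + s - ρ + β))
    (hp2 : ρ < s → p = min (ρ + k + 1 - s + α) (s - ρ - 1 + β))
    (hq1 : s + 1 ≤ ρ → q = min (ρ - (s + 1) + α) (k + (s + 1) - ρ + β))
    (hq2 : ρ < s + 1 → q = min (ρ + k + 1 - (s + 1) + α) (s + 1 - ρ - 1 + β)) :
    OppositeDist k s ρ α β p q := by
  have hpar : k = 2 * s ∨ k + 1 = 2 * s := by omega
  by_cases hρ0 : ρ = 0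
  · subst hρ0
    have h1 := hp2 (by omega)
    have h2 := hq2 (by omega)
    clear hp1 hp2 hq1 hq2 hz hs h0
    rcases hpar with hpar | hpar
    · exact Or.inr (Or.inr (Or.inl ⟨rfl, hpar, by omega, by omega⟩))
    · exact Or.inr (Or.inr (Or.inr (Or.inl ⟨rfl, hpar, by omega, by omega⟩)))
  by_cases ha : α = 0
  · have hb := h0 ha
    subst ha hb
    clear hz h0 hα hβ
    rcases Nat.lt_or_ge ρ (s + 1) with h | h
    · have h2 := hq2 h
      refine Or.inr (Or.inl ⟨rfl, by omega, ?_⟩)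
      rcases Nat.lt_or_ge ρ s with h' | h'
      · have h1 := hp2 h'
        clear hp1 hp2 hq1 hq2
        omega
      · have h1 := hp1 h'
        clear hp1 hp2 hq1 hq2
        omega
    · have h1 := hp1 (by omega)
      have h2 := hq1 h
      clear hp1 hp2 hq1 hq2
      exact Or.inl ⟨rfl, h, by omega, by omega⟩
  · have hk' := (hz ha).resolve_left hρ0
    subst hk'
    have h1 := hp1 (by omega)
    have h2 := hq1 (by omega)
    clear hp1 hp2 hq1 hq2 hz h0
    rcases hpar with hpar | hpar
    · exact Or.inr (Or.inr (Or.inr (Or.inr (Or.inl ⟨rfl, by omega, hpar, by omega, by omega⟩))))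
    · exact Or.inr (Or.inr (Or.inr (Or.inr (Or.inr ⟨rfl, by omega, hpar, by omega, by omega⟩))))

/-- A probe of `w s` and `w (s + 1)` identifies the vertices of the face. It does not always tell on
which side of `w 0` the other vertices are, but then they are closer to `w 0` than to the other ends
of the two edges.  On even cycles it also confuses `w 0` with neighbours of `w k`. -/
theorem arith_opposite_edge {k s ρ α β ρ' α' β' p q : ℕ} (hk : 2 ≤ k) (hβ1 : 1 ≤ β)
    (hβ1' : 1 ≤ β') (hβ : β ≤ α + 1) (hα : α ≤ β + 1) (hβ' : β' ≤ α' + 1) (hα' : α' ≤ β' + 1)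
    (h : OppositeDist k s ρ α β p q) (h' : OppositeDist k s ρ' α' β' p q)
    (hρ : ρ ≤ k) (hρ' : ρ' ≤ k)
    (hc : α = 0 ∨ ρ = 0 ∧ ρ' = k ∧ α' ≠ 0) :
    (α = 0 ∧ α' = 0 ∧ ρ = ρ') ∨ (α ≠ 0 ∧ 2 ≤ α' ∧ 2 ≤ β) ∨
    (k + 1 = 2 * s ∧ α = 0 ∧ ρ = 0 ∧ α' = 1 ∧ ρ' = k) := by
  unfold OppositeDist at h h'
  rcases h with h | h | h | h | h | h <;> rcases h' with h' | h' | h' | h' | h' | h' <;> omega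

end SimpleGraph

/-! ### Faces with time for two probes -/

namespace SimpleGraph

variable {V : Type*} {G : SimpleGraph V} [LinearOrder V]

theorem reach_subset_Ioo {y w z : V} (hG : G.IsOuterOrder) (hyw : G.Adj y w) (hwz : G.Adj w z)
    (h1 : y < w) (h2 : w < z) {C : Set V}
    (hC : ∀ c ∈ C, c ∈ Set.Ioo y w ∧ 2 ≤ G.dist y c ∨ c ∈ Set.Ioo w z ∧ 2 ≤ G.dist z c) :
    G.reach C ⊆ Set.Ioo y z := by
  rintro x ⟨c, hc, hx⟩
  rcases hC c hc with ⟨h, hd⟩ | ⟨h, hd⟩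
  · have hx' := hG.nonCrossing.reach_Ioo hyw (Set.singleton_subset_iff.mpr h) ⟨c, rfl, hx⟩
    refine ⟨lt_of_le_of_ne hx'.1 ?_, hx'.2.trans_lt h2⟩
    rintro rfl
    rcases hx with rfl | hx
    · simp at hd
    · rw [dist_eq_one_iff_adj.mpr hx.symm] at hd
      omega
  · have hx' := hG.nonCrossing.reach_Ioo hwz (Set.singleton_subset_iff.mpr h) ⟨c, rfl, hx⟩
    refine ⟨h1.trans_le hx'.1, lt_of_le_of_ne hx'.2 ?_⟩
    rintro rfl
    rcases hx with rfl | hx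
    · simp at hd
    · rw [dist_eq_one_iff_adj.mpr hx.symm] at hd
      omega

namespace IsPos

variable {k i α β : ℕ} {w : ℕ → V} {x : V}

theorem mem_Ioo (h : G.IsPos k w x i α β) (hα : α ≠ 0) :
    i < k ∧ x ∈ Set.Ioo (w i) (w (i + 1)) := by
  have hi : i < k := lt_of_le_of_ne h.le fun hi => hα (h.zero_of_last hi)
  exact ⟨hi, lt_of_le_of_ne h.mem_le fun he => hα (h.zero_of_eq he.symm), h.mem_lt hi⟩

end IsPos

namespace IsFace

variable {u v : V} {k : ℕ} {w : ℕ → V} [Fintype V] [Nonempty V]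

theorem wins_reach_of_subset_Ioo (h : G.IsFace u v k w) (hG : G.IsOuterOrder)
    (ih : G.WinsBelow (G.chordFinset u v).card) {M i : ℕ} (hi : i < k) {C : Set V}
    (hC : C ⊆ Set.Ioo (w i) (w (i + 1))) (hne : C.Nonempty)
    (hM : (G.chordFinset (w i) (w (i + 1))).card ≤ M) : G.Wins M (G.reach C) := by
  obtain ⟨x, hx⟩ := hne
  exact ih.wins (h.lt_succ i hi) (h.adj i hi) (fun hc => hc.2 (hC hx).1 (hC hx).2)
    (h.card_chordFinset_lt hi) hM (hG.nonCrossing.reach_Ioo (h.adj i hi) hC)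

/-- If the robber was below one of two consecutive edges, not adjacent to the outer end of this
edge, then he cannot have moved to one of the outer ends. -/
theorem wins_reach_of_two_le_dist (h : G.IsFace u v k w) (hG : G.IsOuterOrder)
    (ih : G.WinsBelow (G.chordFinset u v).card) {M i : ℕ} (hi : i + 1 < k) {C : Set V}
    (hC : ∀ c ∈ C, c ∈ Set.Ioo (w i) (w (i + 1)) ∧ 2 ≤ G.dist (w i) c ∨
      c ∈ Set.Ioo (w (i + 1)) (w (i + 2)) ∧ 2 ≤ G.dist (w (i + 2)) c) (hM1 : 1 ≤ M)
    (hM : (G.chordFinset (w i) (w (i + 1))).card +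
      (G.chordFinset (w (i + 1)) (w (i + 2))).card ≤ M) :
    G.Wins M (G.reach C) := by
  have hi' : i < k := by omega
  exact ih.wins_Ioo hG (h.lt_succ i hi') (h.adj i hi') (h.lt_succ (i + 1) hi) (h.adj (i + 1) hi)
    (h.card_chordFinset_lt hi') (h.card_chordFinset_lt hi) hM1 hM
    (reach_subset_Ioo hG (h.adj i hi') (h.adj (i + 1) hi)
      (h.lt_succ i hi') (h.lt_succ (i + 1) hi) hC)

/-- If the answer of a probe determines `i + α` and `β - i`, then the robber is located, or known
to be below one edge of the face, or known to be below one of two consecutive edges and closer to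
their common end than to their other ends. -/
theorem subset_or_wins_of_local (h : G.IsFace u v k w) (hG : G.IsOuterOrder)
    (ih : G.WinsBelow (G.chordFinset u v).card) {M : ℕ} (hM1 : 1 ≤ M)
    (hMi : ∀ i < k, (G.chordFinset (w i) (w (i + 1))).card ≤ M)
    (hMj : ∀ i, i + 1 < k → (G.chordFinset (w i) (w (i + 1))).card +
      (G.chordFinset (w (i + 1)) (w (i + 2))).card ≤ M) {C : Set V} (hC : C ⊆ Set.Icc u v) {x : V}
    (hx : x ∈ C) (hloc : ∀ c ∈ C, ∀ d ∈ C, ∀ i α β i' α' β', G.IsPos k w c i α β →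
      G.IsPos k w d i' α' β' → i + α = i' + α' ∧ β + i' = β' + i) :
    C ⊆ {x} ∨ G.Wins M (G.reach C) := by
  obtain ⟨i, α, β, hp⟩ := h.exists_isPos hG (hC hx)
  have hb := hp.beta_le
  have ha := hp.alpha_le
  by_cases h0 : α = 0
  · left
    intro d hd
    obtain ⟨i', α', β', hp'⟩ := h.exists_isPos hG (hC hd)
    have hl := hloc x hx d hd _ _ _ _ _ _ hp hp'
    have h1 := hp.eq_of_zero h0
    have h2 := hp'.one_le
    have h3 := hp'.eq_of_zero (by omega)
    have h4 : i = i' := by omega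
    rw [Set.mem_singleton_iff, h3.1, h1.1, h4]
  right
  have hall : ∀ d ∈ C, ∃ i' α' β', G.IsPos k w d i' α' β' ∧ i + α = i' + α' ∧ β + i' = β' + i ∧
      i' < k ∧ d ∈ Set.Ioo (w i') (w (i' + 1)) ∧ β' ≤ α' + 1 ∧ α' ≤ β' + 1 := by
    intro d hd
    obtain ⟨i', α', β', hp'⟩ := h.exists_isPos hG (hC hd)
    have hl := hloc x hx d hd _ _ _ _ _ _ hp hp'
    have hb := hp.one_le
    have hd' := hp'.mem_Ioo fun h0' => by
      have := hp'.eq_of_zero h0'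
      omega
    exact ⟨i', α', β', hp', hl.1, hl.2, hd'.1, hd'.2, hp'.beta_le, hp'.alpha_le⟩
  have hik := (hp.mem_Ioo h0).1
  by_cases hone : ∀ d ∈ C, d ∈ Set.Ioo (w i) (w (i + 1))
  · exact h.wins_reach_of_subset_Ioo hG ih hik hone ⟨x, hx⟩ (hMi i hik)
  push Not at hone
  obtain ⟨e, he, hei⟩ := hone
  obtain ⟨i₁, α₁, β₁, hp₁, h₁, h₁', hk₁, hm₁, hb₁, ha₁⟩ := hall e he
  have hne : i₁ ≠ i := fun hc => hei (hc ▸ hm₁)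
  -- the two parts that occur are consecutive
  obtain ⟨j, hj, hjj⟩ : ∃ j, j + 1 < k ∧ ∀ d ∈ C,
      ∀ i' α' β', G.IsPos k w d i' α' β' → (i' = j ∧ 2 ≤ α') ∨ (i' = j + 1 ∧ 2 ≤ β') := by
    have := hp.one_le
    have := hp₁.one_le
    by_cases hlt : i < i₁
    · refine ⟨i, by omega, fun d hd i' α' β' hp' => ?_⟩
      have hl := hloc x hx d hd _ _ _ _ _ _ hp hp'
      have := hp'.beta_le
      have := hp'.alpha_le
      have := hp'.one_le
      omega
    · refine ⟨i₁, by omega, fun d hd i' α' β' hp' => ?_⟩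
      have hl := hloc x hx d hd _ _ _ _ _ _ hp hp'
      have := hp'.beta_le
      have := hp'.alpha_le
      have := hp'.one_le
      omega
  refine h.wins_reach_of_two_le_dist hG ih hj (fun c hc => ?_) hM1 (hMj j hj)
  obtain ⟨i', α', β', hp', -, -, hk', hm', -, -⟩ := hall c hc
  rcases hjj c hc _ _ _ hp' with ⟨rfl, h2⟩ | ⟨rfl, h2⟩
  · exact Or.inl ⟨hm', by rw [hp'.dist_left]; exact h2⟩
  · exact Or.inr ⟨hm', by rw [← hp'.dist_right hk'] at h2; exact h2⟩

/-- The cops probe both ends of the first half of the face. -/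
theorem wins_lower_half (h : G.IsFace u v k w) (hG : G.IsOuterOrder)
    (ih : G.WinsBelow (G.chordFinset u v).card) {M : ℕ} (hM1 : 2 ≤ M)
    (hMi : ∀ i < k, (G.chordFinset (w i) (w (i + 1))).card ≤ M - 1)
    (hMj : ∀ i, i + 1 < k → (G.chordFinset (w i) (w (i + 1))).card +
      (G.chordFinset (w (i + 1)) (w (i + 2))).card ≤ M - 1) :
    G.Wins M (Set.Icc (w 0) (w ((k + 1) / 2))) := by
  have hk := h.two_le
  obtain ⟨s, hs⟩ : ∃ s, s = (k + 1) / 2 := ⟨_, rfl⟩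
  rw [← hs]
  have hS : Set.Icc (w 0) (w s) ⊆ Set.Icc u v := fun x hx =>
    ⟨h.zero ▸ hx.1, hx.2.trans (h.mem_Icc (by omega)).2⟩
  refine Wins.of_probe (by omega) (w 0) (w s) fun x hx => ?_
  refine h.subset_or_wins_of_local hG ih (by omega) hMi hMj (fun c hc => hS hc.1)
    (mem_probeClass_self hx) ?_
  have key : ∀ c ∈ Set.Icc (w 0) (w s), ∀ i α β, G.IsPos k w c i α β →
      G.dist (w 0) c = i + α ∧ G.dist (w s) c + i + 1 = s + β := by
    intro c hc i α β hp
    have his : i ≤ s := by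
      by_contra hlt
      exact absurd (hp.mem_le.trans hc.2) (not_le.mpr (h.lt_of_lt (not_le.mp hlt) hp.le))
    refine arith_half_low hs his hp.beta_le hp.alpha_le hp.one_le (fun his' => ?_) hp.dist_first
      (hp.dist_gt s (by omega)) (hp.dist_le s)
    subst his'
    exact hp.zero_of_eq (le_antisymm hc.2 hp.mem_le)
  rintro c hc d hd i α β i' α' β' hp hp'
  have h1 := key c hc.1 _ _ _ hp
  have h2 := key d hd.1 _ _ _ hp'
  have h3 := hc.2.1.trans hd.2.1.symm
  have h4 := hc.2.2.trans hd.2.2.symm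
  omega

/-- The cops probe both ends of the second half of the face. -/
theorem wins_upper_half (h : G.IsFace u v k w) (hG : G.IsOuterOrder)
    (ih : G.WinsBelow (G.chordFinset u v).card) {M : ℕ} (hM1 : 2 ≤ M)
    (hMi : ∀ i < k, (G.chordFinset (w i) (w (i + 1))).card ≤ M - 1)
    (hMj : ∀ i, i + 1 < k → (G.chordFinset (w i) (w (i + 1))).card +
      (G.chordFinset (w (i + 1)) (w (i + 2))).card ≤ M - 1) :
    G.Wins M (Set.Icc (w (k / 2)) (w k)) := by
  have hk := h.two_le
  obtain ⟨s, hs⟩ : ∃ s, s = k / 2 := ⟨_, rfl⟩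
  rw [← hs]
  have hS : Set.Icc (w s) (w k) ⊆ Set.Icc u v := fun x hx =>
    ⟨(h.mem_Icc (i := s) (by omega)).1.trans hx.1, h.last ▸ hx.2⟩
  refine Wins.of_probe (by omega) (w s) (w k) fun x hx => ?_
  refine h.subset_or_wins_of_local hG ih (by omega) hMi hMj (fun c hc => hS hc.1)
    (mem_probeClass_self hx) ?_
  have key : ∀ c ∈ Set.Icc (w s) (w k), ∀ i α β, G.IsPos k w c i α β →
      G.dist (w s) c + s = i + α ∧ G.dist (w k) c + i + 1 = k + β := by
    intro c hc i α β hp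
    have his : s ≤ i := by
      by_contra hlt
      have h1 := hp.mem_lt (by omega)
      exact absurd (hc.1.trans_lt h1) (not_lt.mpr (h.le_of_le (by omega) (by omega)))
    exact arith_half_high hs his hp.le hp.beta_le hp.alpha_le hp.one_le hp.zero_of_last
      (hp.dist_le s his) hp.dist_last
  rintro c hc d hd i α β i' α' β' hp hp'
  have h1 := key c hc.1 _ _ _ hp
  have h2 := key d hd.1 _ _ _ hp'
  have h3 := hc.2.1.trans hd.2.1.symm
  have h4 := hc.2.2.trans hd.2.2.symm
  omega

/-- If there is enough time for two probes at the face, then the cops first probe its ends `u` and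
`v`, in order to find out in which half of the face the robber is. -/
theorem wins_of_two_probes (h : G.IsFace u v k w) (hG : G.IsOuterOrder)
    (ih : G.WinsBelow (G.chordFinset u v).card) {M : ℕ} (hM1 : 3 ≤ M)
    (hMi : ∀ i < k, (G.chordFinset (w i) (w (i + 1))).card ≤ M - 2)
    (hMj : ∀ i, i + 1 < k → (G.chordFinset (w i) (w (i + 1))).card +
      (G.chordFinset (w (i + 1)) (w (i + 2))).card ≤ M - 2) :
    G.Wins M (Set.Icc u v) := by
  have hk := h.two_le
  refine Wins.of_probe (by omega) (w 0) (w k) fun x hx => ?_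
  set C := G.probeClass (Set.Icc u v) (w 0) (w k) x with hCdef
  have hsing : ∀ z, (z = w 0 ∨ z = w k) → z ∈ C → C ⊆ {x} := by
    have h1 : ∀ z, (z = w 0 ∨ z = w k) → z ∈ C → ∀ c ∈ C, c = z := by
      rintro z (rfl | rfl) hz c hc
      · have := hc.2.1.trans hz.2.1.symm
        rw [dist_self] at this
        exact (hG.connected.dist_eq_zero_iff.mp this).symm
      · have := hc.2.2.trans hz.2.2.symm
        rw [dist_self] at this
        exact (hG.connected.dist_eq_zero_iff.mp this).symm
    intro z hz hzC c hc
    rw [Set.mem_singleton_iff, h1 z hz hzC c hc, h1 z hz hzC x (mem_probeClass_self hx)]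
  by_cases h0 : w 0 ∈ C
  · exact Or.inl (hsing _ (Or.inl rfl) h0)
  by_cases hl : w k ∈ C
  · exact Or.inl (hsing _ (Or.inr rfl) hl)
  have hin : ∀ c ∈ C, ∀ i α β, G.IsPos k w c i α β → i < k ∧ c ≠ u ∧ (α = 0 → 1 ≤ i) := by
    intro c hc i α β hp
    refine ⟨lt_of_le_of_ne hp.le fun hi => hl ?_, fun hcu => h0 ?_, fun ha => ?_⟩
    · have := (hp.eq_of_zero (hp.zero_of_last hi)).1
      rwa [this, hi] at hc
    · rwa [hcu, ← h.zero] at hc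
    · by_contra hi
      have := (hp.eq_of_zero ha).1
      rw [this, show i = 0 by omega] at hc
      exact h0 hc
  have hd : ∀ c ∈ C, ∀ i α β, G.IsPos k w c i α β →
      G.dist (w 0) x = min (i + α) (k - i + β) ∧
      G.dist (w k) x + 1 = min (i + 1 + α + 1) (k - i + β) := by
    intro c hc i α β hp
    rw [← hc.2.1, ← hc.2.2]
    exact ⟨hp.dist_first, hp.dist_last⟩
  rcases lt_trichotomy (G.dist (w 0) x) (G.dist (w k) x) with hlt | heq | hlt
  · right
    refine (h.wins_lower_half hG ih (by omega) (fun i hi => (hMi i hi).trans (by omega))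
      (fun i hi => (hMj i hi).trans (by omega))).mono ?_
    rintro y ⟨c, hc, hcy⟩
    obtain ⟨i, α, β, hp⟩ := h.exists_isPos hG hc.1
    obtain ⟨hik, hcu, hα0⟩ := hin c hc _ _ _ hp
    have hdc := hd c hc _ _ _ hp
    have hb := hp.beta_le
    have ha := hp.alpha_le
    have hcy' : c = y ∨ G.Adj c y := hcy.imp Eq.symm id
    exact ⟨h.le_adj hG hp hik hcu (Nat.zero_le _) (fun h0 => hα0 h0) hcy',
      (h.adj_le hG hp hik hcu hcy').trans (h.le_of_le (by omega) (by omega))⟩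
  · refine h.subset_or_wins_of_local hG ih (by omega) (fun i hi => (hMi i hi).trans (by omega))
      (fun i hi => (hMj i hi).trans (by omega)) (fun c hc => hc.1) (mem_probeClass_self hx) ?_
    intro c hc d hd' i α β i' α' β' hp hp'
    have h1 := hd c hc _ _ _ hp
    have h2 := hd d hd' _ _ _ hp'
    have h3 := hp.le
    have h4 := hp'.le
    omega
  · right
    refine (h.wins_upper_half hG ih (by omega) (fun i hi => (hMi i hi).trans (by omega))
      (fun i hi => (hMj i hi).trans (by omega))).mono ?_
    rintro y ⟨c, hc, hcy⟩
    obtain ⟨i, α, β, hp⟩ := h.exists_isPos hG hc.1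
    obtain ⟨hik, hcu, hα0⟩ := hin c hc _ _ _ hp
    have hdc := hd c hc _ _ _ hp
    have hb := hp.beta_le
    have ha := hp.alpha_le
    have hb1 := hp.one_le
    have h00 := hp.eq_of_zero
    have hcy' : c = y ∨ G.Adj c y := hcy.imp Eq.symm id
    refine ⟨h.le_adj hG hp hik hcu (by omega) (fun h0 => ?_) hcy',
      (h.adj_le hG hp hik hcu hcy').trans (h.le_of_le (by omega) le_rfl)⟩
    have := (h00 h0).2
    omega

end IsFace
end SimpleGraph

/-! ### Faces with time for one probe -/

namespace SimpleGraph

variable {V : Type*} {G : SimpleGraph V} [LinearOrder V]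

/-- The distances from the vertices of a face when the vertices of the face are counted cyclically
from `w j`: `o` is the `s`-th vertex after `w j`, and `ρ` is the number of the vertex `w i`. -/
theorem IsPos.dist_cyclic {k i α β : ℕ} {w : ℕ → V} {x : V} (h : G.IsPos k w x i α β) {j s o ρ : ℕ}
    (hj : j ≤ k) (hs : s ≤ k) (ho : o = if j + s ≤ k then j + s else j + s - (k + 1))
    (hρ : ρ = if j ≤ i then i - j else i + k + 1 - j) :
    (s ≤ ρ → G.dist (w o) x = min (ρ - s + α) (k + s - ρ + β)) ∧
    (ρ < s → G.dist (w o) x = min (ρ + k + 1 - s + α) (s - ρ - 1 + β)) := by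
  have hi := h.le
  have hok : o ≤ k := by split_ifs at ho <;> omega
  rcases Nat.lt_or_ge i o with hio | hio
  · rw [h.dist_gt o hok hio]
    split_ifs at ho hρ <;> constructor <;> intro <;> congr 1 <;> omega
  · rw [h.dist_le o hio]
    split_ifs at ho hρ <;> constructor <;> intro <;> congr 1 <;> omega

namespace IsFace

variable {u v : V} {k : ℕ} {w : ℕ → V} [Fintype V] [Nonempty V]

/-- If only two consecutive edges `w (j - 1) w j` and `w j w (j + 1)` of the face have vertices
below them, then the cops probe two adjacent vertices of the face that are opposite to `w j`.
They locate the robber, find the edge that he is below, or know that he is not adjacent to the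
outer ends of the two edges.  If the face is an even cycle, then it may also happen that he is
either at `w j` or at a neighbour of `w (j - 1)` below the first edge. -/
theorem wins_of_covBy (h : G.IsFace u v k w) (hG : G.IsOuterOrder)
    (ih : G.WinsBelow (G.chordFinset u v).card) {j : ℕ} (hj : j < k)
    (hjn : ∀ i < k, i ≠ j → i + 1 ≠ j → w i ⋖ w (i + 1))
    (hjj : w j ⋖ w (j + 1) → ∀ i < k, w i ⋖ w (i + 1)) :
    G.Wins (G.chordFinset u v).card (Set.Icc u v) := by
  have hk := h.two_le
  have hf1 := h.card_chordFinset_lt hj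
  have hf2 : ∀ l, l + 1 = j → (G.chordFinset (w l) (w (l + 1))).card +
      (G.chordFinset (w (l + 1)) (w (l + 2))).card ≤ (G.chordFinset u v).card - 1 := by
    rintro l rfl
    have := h.sum_card_chordFinset_lt {l, l + 1} (by simp; omega)
    rw [Finset.sum_pair (by omega), show l + 1 + 1 = l + 2 from rfl] at this
    omega
  obtain ⟨s, hs⟩ : ∃ s, s = (k + 1) / 2 := ⟨_, rfl⟩
  obtain ⟨o, ho⟩ : ∃ o, o = if j + s ≤ k then j + s else j + s - (k + 1) := ⟨_, rfl⟩
  obtain ⟨o', ho'⟩ : ∃ o, o = if j + (s + 1) ≤ k then j + (s + 1) else j + (s + 1) - (k + 1) :=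
    ⟨_, rfl⟩
  have hok : o ≤ k := by split_ifs at ho <;> omega
  refine Wins.of_probe (by omega) (w o) (w o') fun x hx => ?_
  set C := G.probeClass (Set.Icc u v) (w o) (w o') x with hCdef
  have hpos : ∀ c ∈ C, ∃ i α β ρ, G.IsPos k w c i α β ∧ ρ ≤ k ∧
      (i = j + ρ ∨ i + k + 1 = j + ρ) ∧ (α ≠ 0 → (ρ = 0 ∧ i = j) ∨ (ρ = k ∧ i + 1 = j)) ∧
      OppositeDist k s ρ α β (G.dist (w o) x) (G.dist (w o') x) := by
    intro c hc
    obtain ⟨i, α, β, hp⟩ := h.exists_isPos hG hc.1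
    obtain ⟨ρ, hρ⟩ : ∃ ρ, ρ = if j ≤ i then i - j else i + k + 1 - j := ⟨_, rfl⟩
    have hi := hp.le
    have hz : α ≠ 0 → (ρ = 0 ∧ i = j) ∨ (ρ = k ∧ i + 1 = j) := by
      intro hα
      have hik := (hp.mem_Ioo hα).1
      by_cases h1 : i = j
      · exact Or.inl ⟨by rw [hρ, if_pos h1.ge]; omega, h1⟩
      by_cases h2 : i + 1 = j
      · exact Or.inr ⟨by rw [hρ, if_neg (by omega)]; omega, h2⟩
      · exact absurd (hp.zero_of_covBy hik (hjn i hik h1 h2)) hα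
    have hρk : ρ ≤ k := by split_ifs at hρ <;> omega
    have d1 := hp.dist_cyclic (s := s) hj.le (by omega) ho hρ
    have d2 := hp.dist_cyclic (s := s + 1) hj.le (by omega) ho' hρ
    rw [hc.2.1] at d1
    rw [hc.2.2] at d2
    exact ⟨i, α, β, ρ, hp, hρk, by split_ifs at hρ <;> omega, hz,
      arith_opposite_dist hk hs hρk hp.beta_le hp.alpha_le hp.one_le
        (fun h0 => (hp.eq_of_zero h0).2)
        (fun hα => (hz hα).imp And.left And.left) d1.1 d1.2 d2.1 d2.2⟩
  -- whether a vertex of the face is consistent with the answer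
  by_cases hbare : ∃ c ∈ C, ∃ i β ρ, G.IsPos k w c i 0 β ∧ ρ ≤ k ∧
      (i = j + ρ ∨ i + k + 1 = j + ρ) ∧
      OppositeDist k s ρ 0 β (G.dist (w o) x) (G.dist (w o') x)
  · obtain ⟨c, hc, i, β, ρ, hp, hρ, hiρ, hO⟩ := hbare
    have hcase : ∀ d ∈ C, d = c ∨ k + 1 = 2 * s ∧ c = w j ∧
        ∃ l, l + 1 = j ∧ d ∈ Set.Ioo (w l) (w (l + 1)) ∧ G.dist (w l) d = 1 := by
      intro d hd
      obtain ⟨i', α', β', ρ', hp', hρ', hiρ', hz', hO'⟩ := hpos d hd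
      have hik := hp.le
      have hik' := hp'.le
      rcases arith_opposite_edge hk hp.one_le hp'.one_le hp.beta_le hp.alpha_le hp'.beta_le
        hp'.alpha_le hO hO' hρ hρ' (Or.inl rfl) with ⟨-, h1, h2⟩ | ⟨h1, -⟩ | ⟨h1, -, h2, h3, h4⟩
      · left
        rw [(hp.eq_of_zero rfl).1, (hp'.eq_of_zero h1).1, show i' = i by omega]
      · exact absurd rfl h1
      · right
        have hm := hp'.mem_Ioo (by omega)
        have hl := (hz' (by omega)).resolve_left (by omega)
        exact ⟨h1, by rw [(hp.eq_of_zero rfl).1, show i = j by omega], i', hl.2, hm.2,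
          hp'.dist_left.trans h3⟩
    by_cases hall : ∀ d ∈ C, d = c
    · left
      intro d hd
      rw [Set.mem_singleton_iff, hall d hd, hall x (mem_probeClass_self hx)]
    right
    push Not at hall
    obtain ⟨d, hd, hdc⟩ := hall
    obtain ⟨hpar, hcj, l, rfl, hdm, hd1⟩ := (hcase d hd).resolve_left hdc
    have hlk : l < k := by omega
    have hn : ¬ w l ⋖ w (l + 1) := fun hcov => hcov.2 hdm.1 hdm.2
    have hn' : ¬ w (l + 1) ⋖ w (l + 2) := fun hcov => hn (hjj hcov l hlk)
    have hoo : ∀ m < k, w o ∉ Set.Ioo (w m) (w (m + 1)) := fun m hm => h.notMem_Ioo hm hok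
    -- the distances of the probed vertex `w o` and the three vertices around `w (l + 1)`
    have hv : ∀ m ≤ k, G.dist (w o) (w m) =
        if o ≤ m then min (m - o) (o + k + 1 - m) else min (o - m) (m + k + 1 - o) := by
      intro m hm
      split_ifs with hom
      · exact h.dist_apply hG hom hm
      · rw [dist_comm]
        exact h.dist_apply hG (by omega) hok
    have v1 := hv l (by omega)
    have v2 := hv (l + 1) (by omega)
    have v3 := hv (l + 1 + 1) (by omega)
    have v4 := h.dist_apply hG (i := l) (j := l + 1 + 1) (by omega) (by omega)
    have hpj := h.isPos_vertex hG (i := l + 1) hj.le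
    have hju : w (l + 1) ≠ u := by
      rw [← h.zero]
      exact (h.lt_of_lt (by omega) hj.le).ne'
    -- by the parity of the face, `w o` is opposite to `w (l + 1)`
    refine ih.wins_Icc hG (h.lt_succ l hlk) (h.adj l hlk) (h.lt_succ (l + 1) hj)
      (h.adj (l + 1) hj) hn hn' (hoo l hlk) (hoo (l + 1) hj) (by split_ifs at * <;> omega)
      (by split_ifs at * <;> omega) (by omega) (h.card_chordFinset_lt hlk) hf1 (hf2 l rfl)
      (fun y hy => ?_) (fun y hy hwy => ?_)
    · obtain ⟨e, he, hey⟩ := hy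
      rcases hcase e he with rfl | ⟨-, -, l', hl', hem, -⟩
      · rw [hcj] at hey
        have hey' : w (l + 1) = y ∨ G.Adj (w (l + 1)) y := hey.imp Eq.symm id
        exact ⟨h.le_adj hG hpj hj hju (Nat.le_succ l) (fun _ => le_rfl) hey',
          h.adj_le hG hpj hj hju hey'⟩
      · obtain rfl : l' = l := by omega
        have := hG.nonCrossing.reach_Ioo (h.adj l' hlk) (Set.singleton_subset_iff.mpr hem)
          ⟨e, rfl, hey⟩
        exact ⟨this.1, this.2.trans (h.lt_succ _ hj).le⟩
    · obtain ⟨e, he, hey⟩ := hy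
      rcases hcase e he with rfl | ⟨-, -, l', hl', hem, -⟩
      · rw [hcj] at hey
        rcases hey with rfl | hey
        · simp
        · exact (dist_eq_one_iff_adj.mpr hey).le
      · obtain rfl : l' = l := by omega
        have := hG.nonCrossing.reach_Ioo (h.adj l' hlk) (Set.singleton_subset_iff.mpr hem)
          ⟨e, rfl, hey⟩
        rw [le_antisymm this.2 hwy, dist_self]
        exact Nat.zero_le 1
  right
  have hα : ∀ c ∈ C, ∃ i α β ρ, G.IsPos k w c i α β ∧ ρ ≤ k ∧ α ≠ 0 ∧
      c ∈ Set.Ioo (w i) (w (i + 1)) ∧ ((ρ = 0 ∧ i = j) ∨ (ρ = k ∧ i + 1 = j)) ∧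
      OppositeDist k s ρ α β (G.dist (w o) x) (G.dist (w o') x) := by
    intro c hc
    obtain ⟨i, α, β, ρ, hp, hρ, hiρ, hz, hO⟩ := hpos c hc
    have h0 : α ≠ 0 := by
      rintro rfl
      exact hbare ⟨c, hc, i, β, ρ, hp, hρ, hiρ, hO⟩
    exact ⟨i, α, β, ρ, hp, hρ, h0, (hp.mem_Ioo h0).2, hz h0, hO⟩
  by_cases hR : ∀ c ∈ C, c ∈ Set.Ioo (w j) (w (j + 1))
  · exact h.wins_reach_of_subset_Ioo hG ih hj hR ⟨x, mem_probeClass_self hx⟩ (by omega)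
  push Not at hR
  obtain ⟨b, hb, hbR⟩ := hR
  obtain ⟨l, αb, βb, ρb, hpb, hρb, hb0, hbm, hbz, hbO⟩ := hα b hb
  -- a vertex below one edge is compared with `a` or `b` below the other edge
  have hbz := hbz.resolve_left fun hc => hbR (hc.2 ▸ hbm)
  obtain ⟨hbk, rfl⟩ := hbz
  have hlk : l < k := by omega
  have hf := hf2 l rfl
  by_cases hL : ∀ c ∈ C, c ∈ Set.Ioo (w l) (w (l + 1))
  · exact h.wins_reach_of_subset_Ioo hG ih hlk hL ⟨x, mem_probeClass_self hx⟩ (by omega)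
  push Not at hL
  obtain ⟨a, ha, haL⟩ := hL
  obtain ⟨m, αa, βa, ρa, hpa, hρa, ha0, ham, haz, haO⟩ := hα a ha
  have haz := haz.resolve_right fun hc => haL ((show m = l by omega) ▸ ham)
  have hpos := card_chordFinset_pos (h.lt_succ l hlk) (h.adj l hlk) fun hcov => hcov.2 hbm.1 hbm.2
  refine h.wins_reach_of_two_le_dist hG ih hj (fun c hc => ?_) (by omega) hf
  obtain ⟨i, α, β, ρ, hp, hρ, h0, hm, hz, hO⟩ := hα c hc
  rcases hz with ⟨hz, rfl⟩ | ⟨hz, hz'⟩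
  · right
    refine ⟨hm, ?_⟩
    rw [show l + 2 = l + 1 + 1 by omega, hp.dist_right hj]
    have := arith_opposite_edge hk hp.one_le hpb.one_le hp.beta_le hp.alpha_le hpb.beta_le
      hpb.alpha_le hO hbO hρ hρb (Or.inr ⟨hz, hbk, hb0⟩)
    omega
  · left
    obtain rfl : i = l := by omega
    refine ⟨hm, ?_⟩
    rw [hp.dist_left]
    have := arith_opposite_edge hk hpa.one_le hp.one_le hpa.beta_le hpa.alpha_le hp.beta_le
      hp.alpha_le haO hO hρa hρ (Or.inr ⟨haz.1, hz, h0⟩)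
    omega

/-- Either only two consecutive edges of the face have vertices below them, or every edge and every
pair of consecutive edges misses so many chords that there is time for two probes at the face. -/
theorem wins (h : G.IsFace u v k w) (hG : G.IsOuterOrder)
    (ih : G.WinsBelow (G.chordFinset u v).card) :
    G.Wins (G.chordFinset u v).card (Set.Icc u v) := by
  have hk := h.two_le
  by_cases hall : ∀ i < k, w i ⋖ w (i + 1)
  · exact h.wins_of_covBy hG ih (j := 0) (by omega) (fun i hi _ _ => hall i hi) fun _ => hall
  push Not at hall
  obtain ⟨i₀, hi₀, hn₀⟩ := hall
  by_cases hj : ∃ j < k, ¬ w j ⋖ w (j + 1) ∧ ∀ i < k, i ≠ j → i + 1 ≠ j → w i ⋖ w (i + 1)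
  · obtain ⟨j, hj, hn, hjn⟩ := hj
    exact h.wins_of_covBy hG ih hj hjn fun hc => absurd hc hn
  have hpos : ∀ i < k, ¬ w i ⋖ w (i + 1) → 1 ≤ (G.chordFinset (w i) (w (i + 1))).card :=
    fun i hi hn => card_chordFinset_pos (h.lt_succ i hi) (h.adj i hi) hn
  have hex : ∀ j < k, ∃ i < k, i ≠ j ∧ i + 1 ≠ j ∧ ¬ w i ⋖ w (i + 1) := by
    intro j hjk
    by_contra hno
    push Not at hno
    by_cases hn : w j ⋖ w (j + 1)
    · -- then the edge `w i₀ w (i₀ + 1)` is the only one with vertices below it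
      have hi : ∀ i < k, ¬ w i ⋖ w (i + 1) → i + 1 = j := by
        intro i hi hni
        by_contra hij
        exact hni (hno i hi (fun hij' => hni (hij' ▸ hn)) hij)
      have h0 := hi i₀ hi₀ hn₀
      refine hj ⟨i₀, hi₀, hn₀, fun i hik hne _ => ?_⟩
      by_contra hni
      have := hi i hik hni
      omega
    · exact hj ⟨j, hjk, hn, hno⟩
  have key1 : ∀ i < k, (G.chordFinset (w i) (w (i + 1))).card ≤ (G.chordFinset u v).card - 2 := by
    intro i hi
    obtain ⟨m, hm, hne, -, hnm⟩ := hex i hi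
    have h1 := h.sum_card_chordFinset_lt {i, m} (by simp; omega)
    rw [Finset.sum_pair hne.symm] at h1
    have := hpos m hm hnm
    omega
  have key2 : ∀ i, i + 1 < k → (G.chordFinset (w i) (w (i + 1))).card +
      (G.chordFinset (w (i + 1)) (w (i + 2))).card ≤ (G.chordFinset u v).card - 2 := by
    intro i hi
    obtain ⟨m, hm, hne, hne', hnm⟩ := hex (i + 1) hi
    have h1 := h.sum_card_chordFinset_lt {m, i, i + 1} (by simp; omega)
    rw [Finset.sum_insert (by simp; omega), Finset.sum_pair (by omega),
      show i + 1 + 1 = i + 2 from rfl] at h1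
    have := hpos m hm hnm
    omega
  refine h.wins_of_two_probes hG ih ?_ key1 key2
  have := key1 i₀ hi₀
  have := hpos i₀ hi₀ hn₀
  omega

end IsFace

theorem IsOuterOrder.winsBelow [Fintype V] [Nonempty V] (hG : G.IsOuterOrder) (N : ℕ) :
    G.WinsBelow N := by
  induction N using Nat.strong_induction_on with
  | _ N ih =>
    intro a b hab ha hn hN
    obtain ⟨k, w, h⟩ := hG.exists_isFace hab ha hn
    exact h.wins hG (ih _ hN)

end SimpleGraph

/-! ### The capture time of outerplanar graphs -/

namespace SimpleGraph

variable {V : Type*} {G : SimpleGraph V} [Fintype V]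

/-- The vertices of an outerplanar drawing are ordered by their arguments, that is, the circle is
cut at the point `-1`. -/
theorem IsOuterplanar.exists_isOuterOrder (ho : G.IsOuterplanar) (h2 : G.IsTwoConnected) :
    ∃ _ : LinearOrder V, G.IsOuterOrder ∧
      ∀ a b : V, (∀ x, a ≤ x) → (∀ x, x ≤ b) → G.Adj a b := by
  obtain ⟨D⟩ := ho
  have hinj : Function.Injective fun v => (D.pos v).arg := fun a b hab =>
    D.pos_injective (Complex.ext_norm_arg ((D.norm_pos a).trans (D.norm_pos b).symm) hab)
  let _ : LinearOrder V := LinearOrder.lift' _ hinj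
  have hG : G.NonCrossing := fun a b c d hab hbc hcd hac => D.not_adj_of_arg_lt hab hbc hcd hac
  refine ⟨inferInstance, ⟨hG, h2.2.1, fun a b => hG.adj_of_covBy h2⟩, fun a b ha hb => ?_⟩
  have hne : b ≠ a := by
    rintro rfl
    have : Subsingleton V := ⟨fun x y =>
      ((hb x).antisymm (ha x)).trans ((hb y).antisymm (ha y)).symm⟩
    have h3 := h2.1
    rw [Nat.card_eq_fintype_card] at h3
    have := Fintype.card_le_one_iff_subsingleton.mpr this
    omega
  exact hG.adj_of_forall_adj_lt h2 hne (fun x hx => lt_of_le_of_ne (ha x) hx.ne)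
    (Or.inr fun x => ⟨ha x, hb x⟩)

/-- Two cops win within as many rounds as there are chords below the edge that closes the outer
cycle; this edge counts as a chord below itself. -/
theorem IsOuterOrder.exists_copsLocateWithin [LinearOrder V] (hG : G.IsOuterOrder)
    (h3 : 3 ≤ Fintype.card V)
    (ht : ∀ a b : V, (∀ x, a ≤ x) → (∀ x, x ≤ b) → G.Adj a b) :
    ∃ m, G.CopsLocateWithin 2 m ∧ m + Fintype.card V ≤ G.edgeSet.ncard + 1 ∧
      m + 2 ≤ Fintype.card V := by
  have : Nonempty V := Fintype.card_pos_iff.mp (by omega)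
  obtain ⟨u, hu⟩ := Finite.exists_min (id : V → V)
  obtain ⟨v, hv⟩ := Finite.exists_max (id : V → V)
  have ha := ht u v hu hv
  have huv : u < v := lt_of_le_of_ne (hu v) ha.ne
  have hcard : {x | u < x ∧ x < v}.ncard + 2 = Fintype.card V := by
    have h1 : ({u, v} : Set V)ᶜ = {x | u < x ∧ x < v} := by
      ext x
      simp only [Set.mem_compl_iff, Set.mem_insert_iff, Set.mem_singleton_iff, not_or,
        Set.mem_ofPred_eq]
      exact ⟨fun h => ⟨lt_of_le_of_ne (hu x) (Ne.symm h.1), lt_of_le_of_ne (hv x) h.2⟩,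
        fun h => ⟨h.1.ne', h.2.ne⟩⟩
    rw [← h1, ← Set.ncard_pair huv.ne, add_comm, Set.ncard_add_ncard_compl,
      Nat.card_eq_fintype_card]
  have hn : ¬ u ⋖ v := by
    intro hc
    have : {x | u < x ∧ x < v} = ∅ := Set.eq_empty_of_forall_notMem fun x hx => hc.2 hx.1 hx.2
    rw [this, Set.ncard_empty] at hcard
    omega
  have hle := hG.nonCrossing.card_chordFinset_le hG.adj_of_covBy u v
  refine ⟨(G.chordFinset u v).card, Wins.copsLocateWithin ?_,
    card_chordFinset_add_le hG.adj_of_covBy u v, by omega⟩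
  exact (hG.winsBelow _ u v huv ha hn (Nat.lt_succ_self _)).mono fun x _ => ⟨hu x, hv x⟩

end SimpleGraph

/-- In a 2-connected outerplanar graph the outer cycle is a Hamiltonian cycle `C`, and the chords
are the edges of the graph that are not edges of `C`. -/
theorem proposition3p2 {V : Type*} [Fintype V] [DecidableEq V] (G : SimpleGraph V)
    (h2 : G.IsTwoConnected) (ho : G.IsOuterplanar) :
    (∃ (v : V) (C : G.Walk v v), C.IsHamiltonianCycle) ∧
    (∀ (v : V) (C : G.Walk v v), C.IsHamiltonianCycle →
      G.kLocalizationCaptureTime 2 ≤ ({e | C.IsChord e}.ncard : ℕ∞) + 1) ∧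
    (G.localizationNumber = 2 → G.localizationCaptureTime + 2 ≤ (Fintype.card V : ℕ∞)) := by
  obtain ⟨_, hG, ht⟩ := ho.exists_isOuterOrder h2
  have h3 : 3 ≤ Fintype.card V := Nat.card_eq_fintype_card (α := V) ▸ h2.1
  obtain ⟨m, hm, hm1, hm2⟩ := hG.exists_copsLocateWithin h3 ht
  have hle : G.kLocalizationCaptureTime 2 ≤ m := iInf₂_le m hm
  refine ⟨?_, fun v C hC => ?_, fun hζ => ?_⟩
  · convert SimpleGraph.exists_isHamiltonianCycle h3 hG.adj_of_covBy ht
  · have := hC.ncard_isChord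
    exact hle.trans (by exact_mod_cast (by omega : m ≤ {e | C.IsChord e}.ncard + 1))
  · rw [SimpleGraph.localizationCaptureTime, hζ]
    exact (add_le_add_left hle 2).trans (by exact_mod_cast hm2)
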